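/- Let $k,m,n$ be positive integers with $m\ge n$, let $N=mn$, and let $D_{int}=\{(x,y)\in\mathbb Z^2: 0\le x\le n,\ 0\le y\le m\}$ be the vertex set of the $m\times n$ unit grid graph (edges join points at $\ell_1$-distance $1$). A covering path is a path in this graph (vertices and edges may be repeated) together with a set of stops among its vertices such that each point of $D_{int}$ is at $\ell_1$-distance at most $k$ from a stop. Its cost is the pair (path length, stop count), the length being the number of edges counted with multiplicity. Let $f_{UB\text{-}D}:[1,\infty)\to\mathbb R$ be the continuous piecewise-linear function with turning points at $d=1,2,4,\dots,2k,2k+1$ and $$f_{UB\text{-}D}(1)=2k+1,\qquad f_{UB\text{-}D}(d)=d\left(2k+1-\tfrac d2\right)\ (d=2,4,\dots,2k),\qquad f_{UB\text{-}D}(d)=2k^2+2k+1\ (d\ge 2k+1).$$ Discrete up-and-down paths on $[a,b]\times[0,m]$ (integers $a\le b$). For $d=1$ and for even $d\le 2k$, put $r=2k+1$ if $d=1$ and $r=2k+1-\frac d2$ otherwise. The traversals of the type-$d$ path are the vertical lines $x=\min(a+ir,b)$, $i=0,1,\dots,\lceil (b-a)/r\rceil$. On traversal $i$ there are stops at the heights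 in $[0,m]$ congruent modulo $d$ to $0$ for even $i$ and to $\lfloor d/2\rfloor$ for odd $i$, and a stop at height $m$. For type $2k+1$ (zigzag path), take all $(x,y)\in\mathbb Z^2$ such that $i=\frac{kx+(k+1)y}{2k^2+2k+1}$ is an integer and the radius-$k$ $\ell_1$-ball of $(x,y)$ meets $[a,b]\times[0,m]$; $(x,y)$ belongs to traversal $i$, and the stops are the projections of these points to the rectangle. In all types the stops are visited traversal after traversal in increasing order of $i$, even traversals in one direction (upwards for $d\le 2k$, in order of increasing $x$ for $d=2k+1$) and odd ones in the opposite direction. A mixed path of types $d_1,d_2$ has, for some integer $0\le s\le n$, as its stops those of the type-$d_1$ path on $[0,s]\times[0,m]$ and those of the type-$d_2$ path on $[s,n]\times[0,m]$, and visits first the former and then the latter, in these orders. **Theorem.** (1) The set of all $(L,T)\in\mathbb R^2$ with $T>1$, $\frac L{T-1}\ge 1$ and $$N=(T-1)\,f_{UB\text{-}D}\!\left(\frac{L}{T-1}\right)\qquad(*)$$ is the polyline connecting, in this order, the points $\left(\frac{dN}{f_{UB\text{-}D}(d)},\frac{N}{f_{UB\text{-}D}(d)}+1\right)$ for $d=1,2,4,\dots,2k,2k+1$,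 followed by the horizontal ray from the last point in the direction of increasing $L$. (2) There is an absolute constant $C$ (independent of $k,m,n,L,T$) such that for each such $(L,T)$ there are consecutive terms $d_1<d_2$ of $1,2,4,\dots,2k,2k+1$ and a covering path that is a mixed path of types $d_1,d_2$ and whose length $L'$ and stop count $T'$ satisfy $|L'-L|\le Ckm$ and $|T'-T|\le Ckm$. -/

import Mathlib

noncomputable section

/-- The `ℓ¹` distance on the integer plane. -/
def l1 (p q : ℤ × ℤ) : ℤ := |p.1 - q.1| + |p.2 - q.2|

/-- `D_int`: the integer points `(x, y)` with `0 ≤ x ≤ n` and `0 ≤ y ≤ m`. -/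
def gridPoints (m n : ℕ) : Finset (ℤ × ℤ) := Finset.Icc (0, 0) ((n : ℤ), (m : ℤ))

/-- The `m × n` unit grid: vertices are the points of `D_int`, edges join the points at distance
one (all edge lengths and all node weights are `1`). -/
def unitGrid (m n : ℕ) : SimpleGraph (gridPoints m n) where
  Adj u v := l1 u v = 1
  symm := ⟨fun u v h => by
    simpa only [l1, abs_sub_comm] using h⟩
  loopless := ⟨fun u h => by simp [l1] at h⟩

/-- A covering path for the discrete covering path problem with coverage radius `k`: a path in the
unit grid (a walk, which may pass several times through a vertex or an edge) together with a set of
stops on it such that every integer point of the grid is within distance `k` of a stop. -/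
structure CoveringPath (m n k : ℕ) where
  source : gridPoints m n
  target : gridPoints m n
  walk : (unitGrid m n).Walk source target
  stops : Finset (gridPoints m n)
  stops_on_walk : ∀ v ∈ stops, v ∈ walk.support
  covers : ∀ p : gridPoints m n, ∃ v ∈ stops, l1 p v ≤ k

/-- Path length: the number of edges (each of length one), counted with multiplicity. -/
def CoveringPath.pathLength {m n k : ℕ} (P : CoveringPath m n k) : ℕ := P.walk.length

/-- Stop count. -/
def CoveringPath.stopCount {m n k : ℕ} (P : CoveringPath m n k) : ℕ := P.stops.card

/-- `d (2k + 1 - d/2)`. -/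
def quadValue (k : ℕ) (d : ℝ) : ℝ := d * (2 * k + 1 - d / 2)

/-- The function `f_{UB-D}` on `[1, ∞)` (used at arguments `d ≥ 1` only): the piecewise-linear
function with value `2k+1` at `1`, `quadValue k d` at `d = 2, 4, …, 2k`, and `2k²+2k+1` on
`[2k+1, ∞)`. -/
def fUBD (k : ℕ) (d : ℝ) : ℝ :=
  if d < 2 then (2 - d) * (2 * k + 1) + (d - 1) * quadValue k 2
  else if d < 2 * k then
    (1 - (d / 2 - ⌊d / 2⌋₊)) * quadValue k (2 * ⌊d / 2⌋₊)
      + (d / 2 - ⌊d / 2⌋₊) * quadValue k (2 * ⌊d / 2⌋₊ + 2)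
  else if d < 2 * k + 1 then
    (2 * k + 1 - d) * quadValue k (2 * k) + (d - 2 * k) * (2 * k ^ 2 + 2 * k + 1)
  else 2 * k ^ 2 + 2 * k + 1

/-- The increasing list `1, 2, 4, …, 2k, 2k+1` of turning points, indexed by `j = 0, …, k+1`. -/
def turningPoint (k j : ℕ) : ℕ := if j = 0 then 1 else if j ≤ k then 2 * j else 2 * k + 1

/-- The pairs `(L, T)` with `N = (T-1) f_{UB-D}(L/(T-1))`, where `N = m n`, `T > 1` and
`L/(T-1)` lies in the domain `[1, ∞)` of `f_{UB-D}`. -/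
def tradeoffCurve (k m n : ℕ) : Set (ℝ × ℝ) :=
  {p | 1 < p.2 ∧ 1 ≤ p.1 / (p.2 - 1) ∧
    (m * n : ℝ) = (p.2 - 1) * fUBD k (p.1 / (p.2 - 1))}

/-- The point of the `(L, T)`-plane that belongs to the slope `d = L/(T-1)`. -/
def curveVertex (k m n d : ℕ) : ℝ × ℝ :=
  (d * (m * n) / fUBD k d, (m * n) / fUBD k d + 1)

/-- The polyline through the vertices for `d = 1, 2, 4, …, 2k, 2k+1`, in this order, followed by
the horizontal ray in the direction of increasing `L` from the last vertex. -/
def tradeoffPolyline (k m n : ℕ) : Set (ℝ × ℝ) :=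
  (⋃ j ∈ Finset.range (k + 1),
    segment ℝ (curveVertex k m n (turningPoint k j)) (curveVertex k m n (turningPoint k (j + 1))))
  ∪ {p | (curveVertex k m n (2 * k + 1)).1 ≤ p.1 ∧ p.2 = (curveVertex k m n (2 * k + 1)).2}

/-! Discrete up-and-down paths in the sub-rectangle `[a, b] × [0, m]`. The stops of a path are
described by labels in `ℤ × ℤ`: the first coordinate is the number of the traversal, the second one
increases along the traversal. -/

/-- Separation of consecutive traversals for `d = 1` (where it is `2k+1`) and for even `d ≤ 2k`
(where it is `2k+1-d/2`); the division is that of `ℕ`. -/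
def separation (k d : ℕ) : ℕ := 2 * k + 1 - d / 2

/-- Labels for type `d ∈ {1, 2, 4, …, 2k}`. Traversal `i` is the vertical line through
`min (a + i r) b` with `r = separation k d`; the last traversal is on the right side. On it there
are stops at consecutive distance `d`, starting at height `0` for even `i` and at height `d / 2`
(division in `ℕ`, so `0` for `d = 1`) for odd `i`, and a stop at the top. The label is
`(i, height)`. -/
def upDownLabels (k m d : ℕ) (a b : ℤ) : Set (ℤ × ℤ) :=
  {p | 0 ≤ p.1 ∧ (p.1 = 0 ∨ a + (p.1 - 1) * separation k d < b) ∧ 0 ≤ p.2 ∧ p.2 ≤ m ∧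
    (p.2 = m ∨ p.2 % d = if Even p.1 then 0 else ((d / 2 : ℕ) : ℤ))}

/-- The stop with a given label, for type `d ∈ {1, 2, 4, …, 2k}`. -/
def upDownStop (k d : ℕ) (a b : ℤ) (p : ℤ × ℤ) : ℤ × ℤ :=
  (min (a + p.1 * separation k d) b, p.2)

/-- The centre with label `(i, j)` of the tessellation of `ℤ²` by radius-`k` balls. These are the
points `(x, y)` with `2k²+2k+1 ∣ k x + (k+1) y`, and `(k x + (k+1) y) / (2k²+2k+1) = i`. -/
def tessCentre (k : ℕ) (p : ℤ × ℤ) : ℤ × ℤ :=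
  (p.1 * k + p.2 * (k + 1), p.1 * (k + 1) - p.2 * k)

/-- Labels for type `2k+1` (zigzag): the centres whose ball meets the rectangle. -/
def zigzagLabels (k m : ℕ) (a b : ℤ) : Set (ℤ × ℤ) :=
  {p | ∃ q ∈ Set.Icc (a, (0 : ℤ)) (b, (m : ℤ)), l1 (tessCentre k p) q ≤ k}

/-- The stop with a given label, for type `2k+1`: the centre, projected to the rectangle. -/
def zigzagStop (k m : ℕ) (a b : ℤ) (p : ℤ × ℤ) : ℤ × ℤ :=
  (max a (min (tessCentre k p).1 b), max 0 (min (tessCentre k p).2 m))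

/-- Labels of the type-`d` discrete up-and-down path, `d ∈ {1, 2, 4, …, 2k, 2k+1}`. -/
def stopLabels (k m d : ℕ) (a b : ℤ) : Set (ℤ × ℤ) :=
  if d = 2 * k + 1 then zigzagLabels k m a b else upDownLabels k m d a b

/-- Stops of the type-`d` discrete up-and-down path, `d ∈ {1, 2, 4, …, 2k, 2k+1}`. -/
def labelStop (k m d : ℕ) (a b : ℤ) : ℤ × ℤ → ℤ × ℤ :=
  if d = 2 * k + 1 then zigzagStop k m a b else upDownStop k d a b

/-- The order in which labels are visited: traversal after traversal, even ones forwards and odd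
ones backwards. -/
def UpDownBefore (p q : ℤ × ℤ) : Prop :=
  p.1 < q.1 ∨ (p.1 = q.1 ∧ if Even p.1 then p.2 ≤ q.2 else q.2 ≤ p.2)

/-- The walk `w` is at the stops of the type-`d` path on `[a, b] × [0, m]` at the times `τ`, and
these times respect the up-and-down order. -/
def TraversesUpDown {m n : ℕ} (k d : ℕ) (a b : ℤ) {u v : gridPoints m n}
    (w : (unitGrid m n).Walk u v) (τ : ℤ × ℤ → ℕ) : Prop :=
  (∀ p ∈ stopLabels k m d a b,
    τ p ≤ w.length ∧ (w.getVert (τ p) : ℤ × ℤ) = labelStop k m d a b p) ∧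
  ∀ p ∈ stopLabels k m d a b, ∀ q ∈ stopLabels k m d a b, UpDownBefore p q → τ p ≤ τ q

/-- `P` is a mixed discrete up-and-down path of types `d₁`, `d₂`: for some `s`, its stops are those
of the type-`d₁` path on `[0, s] × [0, m]` and those of the type-`d₂` path on `[s, n] × [0, m]`; it
visits first the former and then the latter, both in the up-and-down order. -/
def CoveringPath.IsMixed {m n k : ℕ} (P : CoveringPath m n k) (d₁ d₂ : ℕ) : Prop :=
  ∃ s : ℕ, s ≤ n ∧
    (∀ v : gridPoints m n, v ∈ P.stops ↔
      (v : ℤ × ℤ) ∈ labelStop k m d₁ 0 s '' stopLabels k m d₁ 0 s ∪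
        labelStop k m d₂ s n '' stopLabels k m d₂ s n) ∧
    ∃ τ₁ τ₂ : ℤ × ℤ → ℕ,
      TraversesUpDown k d₁ 0 s P.walk τ₁ ∧ TraversesUpDown k d₂ s n P.walk τ₂ ∧
      ∀ p ∈ stopLabels k m d₁ 0 s, ∀ q ∈ stopLabels k m d₂ s n, τ₁ p ≤ τ₂ q

end

/-!
On each interval between consecutive turning points `d₁ < d₂` the function `fUBD k` is affine, so
`N = (T - 1) fUBD k (L / (T - 1))` is there a linear equation in `L` and `T - 1`; its solutions with
slope between `d₁` and `d₂` form a segment, and the constant piece of `fUBD k` gives the ray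
(`tradeoffCurve_eq_tradeoffPolyline`).

For the second part, a path of type `d` on a rectangle of width `w` and height `m` has
`w m / fUBD k d` stops and length `d w m / fUBD k d`, up to errors `O(w + m + k)`
(`exists_pathEstimate`). A point of the segment between two vertices of the polyline is a convex
combination `α V₁ + β V₂`, and the mixed path whose types change at `s = ⌊α n⌋` has the required
length and stop count up to `O(k m)` (`exists_mixed_path`). Only an upper bound for the length is
needed: by going back and forth along an edge a walk can be lengthened by any even number, which is
also how the ray is reached.

For the types `1, 2, 4, …, 2k` the traversals are vertical lines at distance `fUBD k d / d`, and the
estimates and the covering property are elementary (`exists_pathEstimate_upDown`).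
For the zigzag type, the balls of radius `k`, each with `2k² + 2k + 1` points, tile the plane:
the centres have pairwise distance at least `2k + 1` (`tessCentre_sep`), hence
`(x, y) ↦ k x + (k + 1) y` is injective modulo `2k² + 2k + 1` on a ball, hence bijective by counting
(`exists_tessCentre_near`). Comparing areas bounds the number of stops. Successive stops on a
traversal have distance at most `2k + 1`. Between two traversals the distance is `O(k)`:
the traversals that meet the octagon of all points near the rectangle are consecutive
(`zigzag_traversals_contiguous`) and leave it at nearby centres (`zigzag_last_close`,
`zigzag_first_close`); since there are `O((w + m) / k + 1)` traversals, all these distances add up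
to `O(w + m + k)`.
-/

/-! ### Walks in the grid -/

theorem l1_comm (p q : ℤ × ℤ) : l1 p q = l1 q p := by
  simp only [l1, abs_sub_comm]

theorem l1_triangle (p q r : ℤ × ℤ) : l1 p r ≤ l1 p q + l1 q r := by
  have h₁ := abs_sub_le p.1 q.1 r.1
  have h₂ := abs_sub_le p.2 q.2 r.2
  simp only [l1]
  linarith

theorem mem_gridPoints {m n : ℕ} {p : ℤ × ℤ} :
    p ∈ gridPoints m n ↔ 0 ≤ p.1 ∧ 0 ≤ p.2 ∧ p.1 ≤ n ∧ p.2 ≤ m := by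
  rw [gridPoints, Finset.mem_Icc, Prod.le_def, Prod.le_def]
  tauto

theorem abs_add_one_sub {a b : ℤ} (h : a < b) : |a + 1 - b| + 1 = |a - b| := by
  rw [abs_of_nonpos (by omega), abs_of_neg (by omega)]
  ring

theorem abs_sub_one_sub {a b : ℤ} (h : b < a) : |a - 1 - b| + 1 = |a - b| := by
  rw [abs_of_nonneg (by omega), abs_of_pos (by omega)]
  ring

/-- A step towards `v` that decreases the `ℓ¹` distance. -/
theorem exists_adj_closer {m n : ℕ} (u v : gridPoints m n) (h : u ≠ v) :
    ∃ u', (unitGrid m n).Adj u u' ∧ l1 u' v + 1 = l1 u v := by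
  obtain ⟨⟨x, y⟩, hu⟩ := u
  obtain ⟨⟨x', y'⟩, hv⟩ := v
  have hu' := mem_gridPoints.1 hu
  have hv' := mem_gridPoints.1 hv
  have key : ∀ a b : ℤ, 0 ≤ a → 0 ≤ b → a ≤ n → b ≤ m → |x - a| + |y - b| = 1 →
      |a - x'| + |b - y'| + 1 = |x - x'| + |y - y'| →
      ∃ u', (unitGrid m n).Adj ⟨(x, y), hu⟩ u' ∧
        l1 u' (⟨(x', y'), hv⟩ : gridPoints m n) + 1 = l1 (x, y) (x', y') :=
    fun a b h₁ h₂ h₃ h₄ h₅ h₆ => ⟨⟨(a, b), mem_gridPoints.2 ⟨h₁, h₂, h₃, h₄⟩⟩, h₅, h₆⟩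
  simp only at hu' hv'
  rcases lt_trichotomy x x' with hx | hx | hx
  · exact key (x + 1) y (by omega) (by omega) (by omega) (by omega) (by simp)
        (by linarith [abs_add_one_sub hx])
  · rcases lt_trichotomy y y' with hy | hy | hy
    · exact key x (y + 1) (by omega) (by omega) (by omega) (by omega) (by simp)
        (by linarith [abs_add_one_sub hy])
    · subst hx hy
      exact absurd rfl h
    · exact key x (y - 1) (by omega) (by omega) (by omega) (by omega) (by simp)
        (by linarith [abs_sub_one_sub hy])
  · exact key (x - 1) y (by omega) (by omega) (by omega) (by omega) (by simp)
        (by linarith [abs_sub_one_sub hx])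

theorem exists_walk_length_eq_l1 {m n : ℕ} (u v : gridPoints m n) :
    ∃ w : (unitGrid m n).Walk u v, (w.length : ℤ) = l1 u v := by
  obtain ⟨N, hN⟩ : ∃ N : ℕ, l1 u v = N :=
    Int.eq_ofNat_of_zero_le (add_nonneg (abs_nonneg _) (abs_nonneg _))
  induction N generalizing u with
  | zero =>
    obtain rfl : u = v := by
      by_contra h
      obtain ⟨u', -, h'⟩ := exists_adj_closer u v h
      have : 0 ≤ l1 u' v := add_nonneg (abs_nonneg _) (abs_nonneg _)
      push_cast at hN
      linarith
    exact ⟨.nil, by simp [l1]⟩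
  | succ N ih =>
    have huv : u ≠ v := by
      rintro rfl
      simp [l1] at hN
      omega
    obtain ⟨u', ha, h'⟩ := exists_adj_closer u v huv
    obtain ⟨w, hw⟩ := ih u' (by push_cast at hN; linarith)
    exact ⟨.cons ha w, by rw [SimpleGraph.Walk.length_cons]; push_cast; linarith⟩

theorem l1_le_of_mem_gridPoints {m n : ℕ} {p q : ℤ × ℤ} (hp : p ∈ gridPoints m n)
    (hq : q ∈ gridPoints m n) : l1 p q ≤ m + n := by
  have hp := mem_gridPoints.1 hp
  have hq := mem_gridPoints.1 hq
  simp only [l1]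
  grind

theorem getVert_append_of_le {V : Type*} {G : SimpleGraph V} {u v x : V} (p : G.Walk u v)
    (q : G.Walk v x) {i : ℕ} (hi : i ≤ p.length) : (p.append q).getVert i = p.getVert i := by
  rw [SimpleGraph.Walk.getVert_append]
  split_ifs with h
  · rfl
  · obtain rfl : i = p.length := by omega
    simp

theorem getVert_append_add {V : Type*} {G : SimpleGraph V} {u v x : V} (p : G.Walk u v)
    (q : G.Walk v x) (i : ℕ) : (p.append q).getVert (p.length + i) = q.getVert i := by
  rw [SimpleGraph.Walk.getVert_append]
  simp

/-- Going back and forth along one edge. -/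
theorem exists_closed_walk {m n : ℕ} (hn : 0 < n) (v : gridPoints m n) (t : ℕ) :
    ∃ w : (unitGrid m n).Walk v v, w.length = 2 * t := by
  obtain ⟨v', hv'⟩ : ∃ v', (unitGrid m n).Adj v v' := by
    obtain ⟨⟨x, y⟩, hv⟩ := v
    have h := mem_gridPoints.1 hv
    simp only at h
    have h₀ : ((0, y) : ℤ × ℤ) ∈ gridPoints m n := mem_gridPoints.2 (by simp; omega)
    have h₁ : ((1, y) : ℤ × ℤ) ∈ gridPoints m n := mem_gridPoints.2 (by simp; omega)
    by_cases hx : x = 0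
    · obtain ⟨w, hw, -⟩ := exists_adj_closer ⟨(x, y), hv⟩ ⟨(1, y), h₁⟩ (by simp [hx])
      exact ⟨w, hw⟩
    · obtain ⟨w, hw, -⟩ := exists_adj_closer ⟨(x, y), hv⟩ ⟨(0, y), h₀⟩ (by simp [hx])
      exact ⟨w, hw⟩
  induction t with
  | zero => exact ⟨.nil, rfl⟩
  | succ t ih =>
    obtain ⟨w, hw⟩ := ih
    exact ⟨.cons hv' (.cons hv'.symm w), by simp [hw]; ring⟩

/-- Points indexed by a finite set `S` can be visited in the order given by `key`. The length of
the walk is controlled by any potential `Φ` that grows, from each index to the next one, by at least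
the distance of the two points. -/
theorem exists_walk_visiting {ι α : Type*} [LinearOrder α] {m n : ℕ} (key : ι → α)
    (pt : ι → ℤ × ℤ) (Φ : ι → ℤ) (u : gridPoints m n) (S : Finset ι)
    (hmem : ∀ p ∈ S, pt p ∈ gridPoints m n) (hΦ : ∀ p ∈ S, 0 ≤ Φ p)
    (hinj : Set.InjOn key S)
    (hstep : ∀ p ∈ S, ∀ q ∈ S, key p < key q → (∀ x ∈ S, ¬(key p < key x ∧ key x < key q)) →
      l1 (pt p) (pt q) + Φ p ≤ Φ q) :
    ∃ (v : gridPoints m n) (w : (unitGrid m n).Walk u v) (τ : ι → ℕ),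
      (∀ p ∈ S, τ p ≤ w.length ∧ (w.getVert (τ p) : ℤ × ℤ) = pt p) ∧
      (∀ p ∈ S, ∀ q ∈ S, key p ≤ key q → τ p ≤ τ q) ∧
      (S = ∅ ∧ w.length = 0 ∨
        ∃ p ∈ S, (v : ℤ × ℤ) = pt p ∧ (∀ x ∈ S, key x ≤ key p) ∧ (w.length : ℤ) ≤ m + n + Φ p) := by
  classical
  induction S using Finset.induction_on_max_value key with
  | empty => exact ⟨u, .nil, fun _ => 0, by simp, by simp, by simp⟩
  | insert a s has hmax ih =>
    have hlt : ∀ x ∈ s, key x < key a := fun x hx =>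
      lt_of_le_of_ne (hmax x hx) fun h => has <| by
        rwa [← hinj (by simp [hx]) (by simp) h]
    obtain ⟨v, w, τ, hτ, hmono, hend⟩ := ih (fun p hp => hmem p (by simp [hp]))
      (fun p hp => hΦ p (by simp [hp])) (hinj.mono (by simp)) (by
        intro p hp q hq hpq hx
        refine hstep p (by simp [hp]) q (by simp [hq]) hpq fun x hxs => ?_
        rcases Finset.mem_insert.1 hxs with rfl | hxs
        · exact fun h => (hlt q hq).not_gt h.2
        · exact hx x hxs)
    obtain ⟨w', hw'⟩ := exists_walk_length_eq_l1 v ⟨pt a, hmem a (by simp)⟩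
    have hτa : ∀ p ∈ s, Function.update τ a (w.length + w'.length) p = τ p := fun p hp =>
      Function.update_of_ne (by rintro rfl; exact has hp) _ _
    refine ⟨_, w.append w', Function.update τ a (w.length + w'.length), ?_, ?_, .inr ⟨a, by simp,
      rfl, ?_, ?_⟩⟩
    · intro p hp
      rcases Finset.mem_insert.1 hp with rfl | hp
      · rw [Function.update_self, getVert_append_add]
        simp
      · rw [hτa p hp, getVert_append_of_le _ _ (hτ p hp).1, SimpleGraph.Walk.length_append]
        exact ⟨(hτ p hp).1.trans (Nat.le_add_right _ _), (hτ p hp).2⟩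
    · intro p hp q hq hpq
      rcases Finset.mem_insert.1 hp with hp | hp <;> rcases Finset.mem_insert.1 hq with hq | hq
      · rw [hp, hq]
      · exact absurd hpq (hp ▸ (hlt q hq).not_ge)
      · rw [hτa p hp, hq, Function.update_self]
        exact (hτ p hp).1.trans (Nat.le_add_right _ _)
      · rw [hτa p hp, hτa q hq]
        exact hmono p hp q hq hpq
    · intro x hx
      rcases Finset.mem_insert.1 hx with rfl | hx
      · rfl
      · exact hmax x hx
    · rw [SimpleGraph.Walk.length_append]
      push_cast
      rw [hw']
      rcases hend with ⟨-, h0⟩ | ⟨p, hp, hv, hpmax, hlen⟩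
      · have := l1_le_of_mem_gridPoints v.2 (hmem a (by simp))
        have := hΦ a (by simp)
        rw [h0]
        push_cast
        linarith
      · have := hstep p (by simp [hp]) a (by simp) (hlt p hp) (by
          intro x hx h
          rcases Finset.mem_insert.1 hx with rfl | hx
          · exact h.2.false
          · exact (hpmax x hx).not_gt h.1)
        rw [hv]
        simp only
        linarith

/-- The position of a label in the up-and-down order. -/
def visitKey (p : ℤ × ℤ) : ℤ ×ₗ ℤ := toLex (p.1, if Even p.1 then p.2 else -p.2)

theorem visitKey_injective : Function.Injective visitKey := by
  rintro ⟨i, j⟩ ⟨i', j'⟩ h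
  simp only [visitKey, EmbeddingLike.apply_eq_iff_eq, Prod.mk.injEq] at h
  obtain ⟨rfl, h⟩ := h
  split_ifs at h <;> simp_all

theorem visitKey_lt_iff {p q : ℤ × ℤ} : visitKey p < visitKey q ↔
    p.1 < q.1 ∨ p.1 = q.1 ∧ if Even p.1 then p.2 < q.2 else q.2 < p.2 := by
  rw [visitKey, visitKey, Prod.Lex.toLex_lt_toLex]
  refine or_congr Iff.rfl (and_congr_right fun h => ?_)
  simp only at h
  rw [← h]
  split_ifs <;> simp

theorem upDownBefore_iff {p q : ℤ × ℤ} : UpDownBefore p q ↔ visitKey p ≤ visitKey q := by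
  rw [visitKey, visitKey, Prod.Lex.toLex_le_toLex, UpDownBefore]
  refine or_congr Iff.rfl (and_congr_right fun h => ?_)
  rw [← h]
  split_ifs <;> simp

/-! ### The tessellation of the plane by `ℓ¹` balls -/

/-- The number of points in a ball of radius `k`. -/
def ballSize (k : ℕ) : ℕ := 2 * k ^ 2 + 2 * k + 1

/-- The ball of radius `k` around `c`. -/
noncomputable def l1Ball (k : ℕ) (c : ℤ × ℤ) : Finset (ℤ × ℤ) :=
  (Finset.Icc (c.1 - k, c.2 - k) (c.1 + k, c.2 + k)).filter fun q => l1 c q ≤ k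

theorem mem_l1Ball {k : ℕ} {c q : ℤ × ℤ} : q ∈ l1Ball k c ↔ l1 c q ≤ k := by
  rw [l1Ball, Finset.mem_filter, Finset.mem_Icc, Prod.le_def, Prod.le_def, and_iff_right_iff_imp]
  intro h
  have h₁ : |c.1 - q.1| ≤ k := (le_add_of_nonneg_right (abs_nonneg _)).trans h
  have h₂ : |c.2 - q.2| ≤ k := (le_add_of_nonneg_left (abs_nonneg _)).trans h
  rw [abs_le] at h₁ h₂
  simp only
  omega

theorem sum_Icc_neg_self (k : ℕ) :
    ∑ x ∈ Finset.Icc (-k : ℤ) k, (2 * (k - |x|) + 1) = ballSize k := by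
  induction k with
  | zero => simp [ballSize]
  | succ k ih =>
    have h : Finset.Icc (-(k + 1 : ℕ) : ℤ) (k + 1 : ℕ) =
        insert (-(k + 1 : ℕ) : ℤ) (insert ((k + 1 : ℕ) : ℤ) (Finset.Icc (-k : ℤ) k)) := by
      ext x
      simp only [Finset.mem_Icc, Finset.mem_insert]
      omega
    rw [h, Finset.sum_insert, Finset.sum_insert]
    · have h' : ∀ x : ℤ, 2 * (((k + 1 : ℕ) : ℤ) - |x|) + 1 = (2 * (k - |x|) + 1) + 2 := by
        intro x
        push_cast
        ring
      simp only [h', Finset.sum_add_distrib, ih]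
      simp only [ballSize, abs_neg, Nat.abs_cast, Finset.sum_const, Int.card_Icc, nsmul_eq_mul]
      have : ((k : ℤ) + 1 - -k).toNat = 2 * k + 1 := by omega
      rw [this]
      push_cast
      ring
    · simp
    · simp
      omega

theorem card_l1Ball (k : ℕ) (c : ℤ × ℤ) : (l1Ball k c).card = ballSize k := by
  have h : l1Ball k c = (Finset.Icc (-k : ℤ) k).biUnion fun x =>
      (Finset.Icc (c.2 - (k - |x|)) (c.2 + (k - |x|))).image fun y => (c.1 + x, y) := by
    ext ⟨x, y⟩
    simp only [mem_l1Ball, l1, Finset.mem_biUnion, Finset.mem_image, Finset.mem_Icc, Prod.mk.injEq]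
    constructor
    · intro h
      exact ⟨x - c.1, by grind, y, by grind, by ring, rfl⟩
    · rintro ⟨x', hx', y', hy', rfl, rfl⟩
      grind
  rw [h, Finset.card_biUnion]
  · zify
    rw [← sum_Icc_neg_self]
    refine Finset.sum_congr rfl fun x hx => ?_
    rw [Finset.card_image_of_injective _ (fun a b h => by simpa using h), Int.card_Icc]
    have := abs_le.2 (Finset.mem_Icc.1 hx)
    omega
  · intro x _ x' _ hxx'
    rw [Function.onFun, Finset.disjoint_left]
    rintro ⟨a, b⟩ h₁ h₂
    simp only [Finset.mem_image, Prod.mk.injEq] at h₁ h₂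
    obtain ⟨_, _, h₁, _⟩ := h₁
    obtain ⟨_, _, h₂, _⟩ := h₂
    omega

/-- Distinct centres have distance at least `2k + 1`; this is seen in the coordinates `x + y`,
`x - y`. -/
theorem tessCentre_sep {k : ℕ} {p q : ℤ × ℤ} (h : l1 (tessCentre k p) (tessCentre k q) ≤ 2 * k) :
    p = q := by
  obtain ⟨i, j⟩ := p
  obtain ⟨i', j'⟩ := q
  simp only [l1, tessCentre] at h
  have h₁ : |(i - i') * (2 * k + 1) + (j - j')| ≤ 2 * k := by
    refine le_trans (le_of_eq_of_le ?_ (abs_add_le _ _)) h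
    congr 1
    ring
  have h₂ : |(j - j') * (2 * k + 1) - (i - i')| ≤ 2 * k := by
    refine le_trans (le_of_eq_of_le ?_ (abs_sub _ _)) h
    congr 1
    ring
  rw [abs_le] at h₁ h₂
  have hk : (0 : ℤ) ≤ k := by positivity
  have hi : i - i' = 0 := by
    by_contra hne
    rcases lt_or_gt_of_ne hne with hi | hi <;>
      rcases lt_trichotomy (j - j') 0 with hj | hj | hj <;> nlinarith
  rw [hi] at h₁ h₂
  have hj : j - j' = 0 := by
    by_contra hne
    rcases lt_or_gt_of_ne hne with hj | hj <;> nlinarith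
  simp only [Prod.mk.injEq]
  omega

/-- The centres form the lattice of all `(x, y)` with `2k² + 2k + 1 ∣ k x + (k + 1) y`. -/
theorem exists_tessCentre_eq {k : ℕ} {q : ℤ × ℤ}
    (h : (ballSize k : ℤ) ∣ k * q.1 + (k + 1) * q.2) : ∃ p, tessCentre k p = q := by
  obtain ⟨x, y⟩ := q
  obtain ⟨i, hi⟩ := h
  simp only [ballSize] at hi
  push_cast at hi
  -- `(k + 1) (k x + (k + 1) y) = k ((k + 1) x - k y) + (2 k² + 2 k + 1) y`
  have hj : (ballSize k : ℤ) ∣ (k + 1) * x - k * y := by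
    have hc : IsCoprime (ballSize k : ℤ) k := ⟨1, -(2 * k + 2), by simp [ballSize]; ring⟩
    refine hc.dvd_of_dvd_mul_left ⟨(k + 1) * i - y, ?_⟩
    simp only [ballSize]
    push_cast
    linear_combination (k + 1 : ℤ) * hi
  obtain ⟨j, hj⟩ := hj
  simp only [ballSize] at hj
  push_cast at hj
  have hF : (2 * k ^ 2 + 2 * k + 1 : ℤ) ≠ 0 := by positivity
  refine ⟨(i, j), ?_⟩
  simp only [tessCentre, Prod.mk.injEq]
  constructor
  · apply mul_left_cancel₀ hF
    linear_combination -(k : ℤ) * hi - (k + 1 : ℤ) * hj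
  · apply mul_left_cancel₀ hF
    linear_combination -(k + 1 : ℤ) * hi + (k : ℤ) * hj

/-- The balls cover the plane: `(x, y) ↦ k x + (k + 1) y` is injective modulo `2k² + 2k + 1` on the
ball around the origin, hence takes all values there. -/
theorem exists_tessCentre_near (k : ℕ) (q : ℤ × ℤ) : ∃ p, l1 (tessCentre k p) q ≤ k := by
  classical
  have : NeZero (ballSize k) := ⟨by simp [ballSize]⟩
  let φ : ℤ × ℤ → ZMod (ballSize k) := fun q => ((k * q.1 + (k + 1) * q.2 : ℤ) : ZMod (ballSize k))
  have hlat : ∀ a b, φ a = φ b → ∃ p, tessCentre k p = (a.1 - b.1, a.2 - b.2) := by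
    intro a b hab
    apply exists_tessCentre_eq
    have := (ZMod.intCast_eq_intCast_iff_dvd_sub _ _ _).1 hab.symm
    convert this using 1
    ring
  have hinj : Set.InjOn φ (l1Ball k 0) := by
    intro a ha b hb hab
    obtain ⟨p, hp⟩ := hlat a b hab
    have ha := mem_l1Ball.1 (Finset.mem_coe.1 ha)
    have hb := mem_l1Ball.1 (Finset.mem_coe.1 hb)
    have h0 : tessCentre k (0, 0) = (0, 0) := by simp [tessCentre]
    have hp0 : p = (0, 0) := by
      apply tessCentre_sep (k := k)
      rw [hp, h0]
      simp only [l1, Prod.fst_zero, Prod.snd_zero] at ha hb ⊢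
      grind
    rw [hp0, h0, Prod.mk.injEq] at hp
    ext <;> omega
  have himg : (l1Ball k 0).image φ = Finset.univ := by
    rw [← Finset.card_eq_iff_eq_univ, Finset.card_image_of_injOn hinj, card_l1Ball, ZMod.card]
  obtain ⟨b, hb, hbq⟩ := Finset.mem_image.1 (himg ▸ Finset.mem_univ (φ q))
  obtain ⟨p, hp⟩ := hlat q b hbq.symm
  refine ⟨p, ?_⟩
  have hb := mem_l1Ball.1 hb
  rw [hp]
  simp only [l1, Prod.fst_zero, Prod.snd_zero] at hb ⊢
  grind

/-! ### Zigzag paths -/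

/-- The points at distance at most `k` from a rectangle form an octagon. -/
theorem mem_zigzagLabels {k m : ℕ} {a b : ℤ} (hab : a ≤ b) {i j : ℤ} :
    (i, j) ∈ zigzagLabels k m a b ↔
      (a ≤ i * k + j * (k + 1) + k ∧ i * k + j * (k + 1) ≤ b + k ∧
        0 ≤ i * (k + 1) - j * k + k ∧ i * (k + 1) - j * k ≤ m + k) ∧
      a ≤ i * k + j * (k + 1) + (i * (k + 1) - j * k) + k ∧
      a + (i * (k + 1) - j * k) ≤ i * k + j * (k + 1) + m + k ∧
      i * k + j * (k + 1) ≤ b + (i * (k + 1) - j * k) + k ∧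
      i * k + j * (k + 1) + (i * (k + 1) - j * k) ≤ b + m + k := by
  simp only [zigzagLabels, tessCentre, Set.mem_ofPred_eq, l1]
  generalize i * (k : ℤ) + j * (k + 1) = x
  generalize i * ((k : ℤ) + 1) - j * k = y
  constructor
  · rintro ⟨⟨u, v⟩, hq, h⟩
    simp only [Set.mem_Icc, Prod.mk_le_mk] at hq
    simp only at h
    have := le_abs_self (x - u)
    have := neg_abs_le (x - u)
    have := le_abs_self (y - v)
    have := neg_abs_le (y - v)
    have := abs_nonneg (x - u)
    have := abs_nonneg (y - v)
    omega
  · intro h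
    refine ⟨(max a (min x b), max 0 (min y m)), ?_, ?_⟩
    · simp only [Set.mem_Icc, Prod.mk_le_mk]
      omega
    · simp only [abs_eq_max_neg]
      omega

theorem zigzagLabels_ordConnected {k m : ℕ} {a b : ℤ} (hab : a ≤ b) {i j j' t : ℤ}
    (hj : (i, j) ∈ zigzagLabels k m a b) (hj' : (i, j') ∈ zigzagLabels k m a b)
    (h : j ≤ t) (h' : t ≤ j') : (i, t) ∈ zigzagLabels k m a b := by
  rw [mem_zigzagLabels hab] at hj hj' ⊢
  have hk : (0 : ℤ) ≤ k := by positivity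
  have h₁ := mul_le_mul_of_nonneg_right h hk
  have h₂ := mul_le_mul_of_nonneg_right h' hk
  refine ⟨⟨?_, ?_, ?_, ?_⟩, ?_, ?_, ?_, ?_⟩ <;> linarith

/-- The last centres on consecutive traversals are close to each other: both traversals leave the
octagon near its right or near its lower side. -/
theorem zigzag_last_close {k m : ℕ} (hk : 1 ≤ k) {a b : ℤ} (hab : a ≤ b) {i j j' : ℤ}
    (hj : (i, j) ∈ zigzagLabels k m a b) (hj₁ : (i, j + 1) ∉ zigzagLabels k m a b)
    (hj' : (i + 1, j') ∈ zigzagLabels k m a b) (hj'₁ : (i + 1, j' + 1) ∉ zigzagLabels k m a b) :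
    |j - j'| ≤ 3 := by
  have hexit : ∀ i j : ℤ, (i, j) ∈ zigzagLabels k m a b → (i, j + 1) ∉ zigzagLabels k m a b →
      b < i * k + j * (k + 1) + k + 1 ∨ i * (k + 1) - j * k < k := by
    intro i j h h'
    by_contra! hc
    rw [mem_zigzagLabels hab] at h h'
    refine h' ⟨⟨?_, ?_, ?_, ?_⟩, ?_, ?_, ?_, ?_⟩ <;> linarith
  have h₁ := hexit _ _ hj hj₁
  have h₂ := hexit _ _ hj' hj'₁
  rw [mem_zigzagLabels hab] at hj hj'
  have hk' : (1 : ℤ) ≤ k := by exact_mod_cast hk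
  rw [abs_le]
  constructor <;> by_contra! hc
  · have h₃ := mul_le_mul_of_nonneg_right (show 4 ≤ j' - j by omega) (zero_le_one.trans hk')
    rcases h₁ with h₁ | h₁ <;> linarith
  · have h₃ := mul_le_mul_of_nonneg_right (show 4 ≤ j - j' by omega) (zero_le_one.trans hk')
    rcases h₂ with h₂ | h₂ <;> linarith

/-- The first centres on consecutive traversals are close to each other. -/
theorem zigzag_first_close {k m : ℕ} (hk : 1 ≤ k) {a b : ℤ} (hab : a ≤ b) {i j j' : ℤ}
    (hj : (i, j) ∈ zigzagLabels k m a b) (hj₁ : (i, j - 1) ∉ zigzagLabels k m a b)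
    (hj' : (i + 1, j') ∈ zigzagLabels k m a b) (hj'₁ : (i + 1, j' - 1) ∉ zigzagLabels k m a b) :
    |j - j'| ≤ 3 := by
  have hexit : ∀ i j : ℤ, (i, j) ∈ zigzagLabels k m a b → (i, j - 1) ∉ zigzagLabels k m a b →
      i * k + j * (k + 1) < a + k + 1 ∨ m < i * (k + 1) - j * k + k := by
    intro i j h h'
    by_contra! hc
    rw [mem_zigzagLabels hab] at h h'
    refine h' ⟨⟨?_, ?_, ?_, ?_⟩, ?_, ?_, ?_, ?_⟩ <;> linarith
  have h₁ := hexit _ _ hj hj₁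
  have h₂ := hexit _ _ hj' hj'₁
  rw [mem_zigzagLabels hab] at hj hj'
  have hk' : (1 : ℤ) ≤ k := by exact_mod_cast hk
  rw [abs_le]
  constructor <;> by_contra! hc
  · have h₃ := mul_le_mul_of_nonneg_right (show 4 ≤ j' - j by omega) (zero_le_one.trans hk')
    rcases h₂ with h₂ | h₂ <;> linarith
  · have h₃ := mul_le_mul_of_nonneg_right (show 4 ≤ j - j' by omega) (zero_le_one.trans hk')
    rcases h₁ with h₁ | h₁ <;> linarith

/-- Adjacent points belong to balls on the same or on consecutive traversals. -/
theorem tessCentre_index_close {k : ℕ} {p p' q q' : ℤ × ℤ} (hp : l1 (tessCentre k p) q ≤ k)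
    (hp' : l1 (tessCentre k p') q' ≤ k) (hq : l1 q q' ≤ 1) : |p'.1 - p.1| ≤ 1 := by
  have h : l1 (tessCentre k p) (tessCentre k p') ≤ 2 * k + 1 := by
    have h₁ := l1_triangle (tessCentre k p) q (tessCentre k p')
    have h₂ := l1_triangle q q' (tessCentre k p')
    rw [l1_comm] at hp'
    linarith
  obtain ⟨i, j⟩ := p
  obtain ⟨i', j'⟩ := p'
  simp only [l1, tessCentre] at h
  set X := i * (k : ℤ) + j * (k + 1) - (i' * k + j' * (k + 1)) with hX
  set Y := i * ((k : ℤ) + 1) - j * k - (i' * (k + 1) - j' * k) with hY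
  have hXY : (2 * k ^ 2 + 2 * k + 1) * (i - i') = k * X + (k + 1) * Y := by
    rw [hX, hY]
    ring
  have hk : (0 : ℤ) ≤ k := by positivity
  have := le_abs_self X
  have := neg_abs_le X
  have := le_abs_self Y
  have := neg_abs_le Y
  have := abs_nonneg X
  have h₁ : k * X + (k + 1) * Y ≤ (k + 1) * (2 * k + 1) := by nlinarith
  have h₂ : -((k + 1) * (2 * k + 1)) ≤ k * X + (k + 1) * Y := by nlinarith
  rw [← hXY] at h₁ h₂
  rw [abs_le]
  simp only
  constructor <;> by_contra! hc
  · have : 2 ≤ i - i' := by omega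
    nlinarith
  · have : i - i' ≤ -2 := by omega
    nlinarith

/-- A discrete intermediate value theorem. -/
theorem exists_eq_of_abs_step_le_one {F : ℤ → ℤ} (hF : ∀ t, |F (t + 1) - F t| ≤ 1) {a b c : ℤ}
    (hc : c ∈ Set.uIcc (F a) (F b)) : ∃ t ∈ Set.uIcc a b, F t = c := by
  wlog hab : a ≤ b generalizing a b
  · rw [Set.uIcc_comm] at hc ⊢
    exact this hc (le_of_not_ge hab)
  rw [Set.uIcc_of_le hab]
  induction b, hab using Int.leInduction with
  | base => exact ⟨a, by simp, by rw [Set.mem_uIcc] at hc; omega⟩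
  | succ b hab ih =>
    by_cases h : c ∈ Set.uIcc (F a) (F b)
    · obtain ⟨t, ht, htc⟩ := ih h
      exact ⟨t, ⟨ht.1, ht.2.trans (by omega)⟩, htc⟩
    · refine ⟨b + 1, ⟨by omega, le_rfl⟩, ?_⟩
      have := abs_le.1 (hF b)
      rw [Set.mem_uIcc] at h hc
      omega

/-- No traversal between two nonempty ones is empty. -/
theorem zigzag_traversals_contiguous {k m : ℕ} {a b : ℤ} {i j i' j' c : ℤ}
    (h : (i, j) ∈ zigzagLabels k m a b) (h' : (i', j') ∈ zigzagLabels k m a b)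
    (hic : i ≤ c) (hci : c ≤ i') : ∃ t, (c, t) ∈ zigzagLabels k m a b := by
  choose g hg using exists_tessCentre_near k
  obtain ⟨⟨x, y⟩, hq, hp⟩ := h
  obtain ⟨⟨x', y'⟩, hq', hp'⟩ := h'
  have huniq : ∀ p q, l1 (tessCentre k p) q ≤ k → g q = p := fun p q hpq => by
    apply tessCentre_sep (k := k)
    have := l1_triangle (tessCentre k (g q)) q (tessCentre k p)
    have := hg q
    rw [l1_comm] at hpq
    linarith
  simp only [Set.mem_Icc, Prod.mk_le_mk] at hq hq'
  have hc : c ∈ Set.uIcc (g (x, y)).1 (g (x', y')).1 := by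
    rw [huniq _ _ hp, huniq _ _ hp']
    exact Set.mem_uIcc.2 (.inl ⟨hic, hci⟩)
  have hF₁ : ∀ t, |(g (t + 1, y)).1 - (g (t, y)).1| ≤ 1 := fun t =>
    tessCentre_index_close (hg _) (hg _) (by simp [l1])
  have hF₂ : ∀ t, |(g (x', t + 1)).1 - (g (x', t)).1| ≤ 1 := fun t =>
    tessCentre_index_close (hg _) (hg _) (by simp [l1])
  have hfin : ∀ q ∈ Set.Icc (a, (0 : ℤ)) (b, (m : ℤ)), (g q).1 = c →
      ∃ t, (c, t) ∈ zigzagLabels k m a b := fun q hq hqc =>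
    ⟨(g q).2, q, hq, by rw [← hqc]; exact hg q⟩
  rcases Set.uIcc_subset_uIcc_union_uIcc (b := (g (x', y)).1) hc with hc | hc
  · obtain ⟨t, ht, htc⟩ := exists_eq_of_abs_step_le_one (F := fun t => (g (t, y)).1) hF₁ hc
    refine hfin _ ?_ htc
    rw [Set.mem_uIcc] at ht
    simp only [Set.mem_Icc, Prod.mk_le_mk]
    omega
  · obtain ⟨t, ht, htc⟩ := exists_eq_of_abs_step_le_one (F := fun t => (g (x', t)).1) hF₂ hc
    refine hfin _ ?_ htc
    rw [Set.mem_uIcc] at ht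
    simp only [Set.mem_Icc, Prod.mk_le_mk]
    omega

theorem tessCentre_injective (k : ℕ) : Function.Injective (tessCentre k) := fun p q h =>
  tessCentre_sep (k := k) (by rw [h]; simp [l1])

theorem tessCentre_mem_of_mem_zigzagLabels {k m : ℕ} {a b : ℤ} {p : ℤ × ℤ}
    (hp : p ∈ zigzagLabels k m a b) :
    (a - k ≤ (tessCentre k p).1 ∧ (tessCentre k p).1 ≤ b + k) ∧
      -k ≤ (tessCentre k p).2 ∧ (tessCentre k p).2 ≤ m + k := by
  obtain ⟨q, hq, h⟩ := hp
  have hab : a ≤ b := hq.1.1.trans hq.2.1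
  have := (mem_zigzagLabels (i := p.1) (j := p.2) hab).1 ⟨q, hq, h⟩
  simp only [tessCentre]
  omega

theorem zigzagLabels_finite (k m : ℕ) (a b : ℤ) : (zigzagLabels k m a b).Finite := by
  refine Set.Finite.of_finite_image ?_ (tessCentre_injective k).injOn
  refine (Set.finite_Icc ((a - k, -k) : ℤ × ℤ) (b + k, m + k)).subset ?_
  rintro _ ⟨p, hp, rfl⟩
  have := tessCentre_mem_of_mem_zigzagLabels hp
  simp only [Set.mem_Icc, Prod.le_def]
  omega

/-- The balls around the centres are disjoint, and contained in the rectangle enlarged by `2k`. -/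
theorem card_mul_ballSize_le {k m w : ℕ} {a : ℤ} {S : Finset (ℤ × ℤ)}
    (hS : ∀ p ∈ S, p ∈ zigzagLabels k m a (a + w)) :
    S.card * ballSize k ≤ (w + 4 * k + 1) * (m + 4 * k + 1) := by
  classical
  have hcard : (S.biUnion fun p => l1Ball k (tessCentre k p)).card = S.card * ballSize k := by
    rw [Finset.card_biUnion, Finset.sum_congr rfl fun p _ => card_l1Ball k _, Finset.sum_const,
      smul_eq_mul]
    intro p _ q _ hpq
    rw [Function.onFun, Finset.disjoint_left]
    intro x hx hx'
    rw [mem_l1Ball] at hx hx'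
    refine hpq (tessCentre_sep (k := k) ?_)
    have := l1_triangle (tessCentre k p) x (tessCentre k q)
    rw [l1_comm _ x] at hx'
    linarith
  rw [← hcard]
  have hsub : (S.biUnion fun p => l1Ball k (tessCentre k p)) ⊆
      Finset.Icc (a - 2 * k, (-(2 * k) : ℤ)) (a + w + 2 * k, (m + 2 * k : ℤ)) := by
    intro x hx
    obtain ⟨p, hp, hx⟩ := Finset.mem_biUnion.1 hx
    have h₁ := tessCentre_mem_of_mem_zigzagLabels (hS p hp)
    rw [mem_l1Ball, l1] at hx
    have := abs_le.1 ((le_add_of_nonneg_right (abs_nonneg _)).trans hx)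
    have := abs_le.1 ((le_add_of_nonneg_left (abs_nonneg _)).trans hx)
    simp only [Finset.mem_Icc, Prod.le_def]
    omega
  refine (Finset.card_le_card hsub).trans (le_of_eq ?_)
  rw [← Finset.Icc_product_Icc, Finset.card_product, Int.card_Icc, Int.card_Icc]
  congr 1 <;> omega

/-- A set of points that covers a rectangle is large. -/
theorem le_card_mul_ballSize {k m w : ℕ} {a : ℤ} {A : Finset (ℤ × ℤ)}
    (hA : ∀ q ∈ Finset.Icc (a, (0 : ℤ)) (a + w, (m : ℤ)), ∃ c ∈ A, l1 q c ≤ k) :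
    (w + 1) * (m + 1) ≤ A.card * ballSize k := by
  classical
  have hsub : Finset.Icc (a, (0 : ℤ)) (a + w, (m : ℤ)) ⊆ A.biUnion (l1Ball k) := by
    intro q hq
    obtain ⟨c, hc, h⟩ := hA q hq
    exact Finset.mem_biUnion.2 ⟨c, hc, mem_l1Ball.2 (l1_comm q c ▸ h)⟩
  have h := (Finset.card_le_card hsub).trans
    (Finset.card_biUnion_le_card_mul A (l1Ball k) (ballSize k) fun c _ => (card_l1Ball k c).le)
  rw [← Finset.Icc_product_Icc, Finset.card_product, Int.card_Icc, Int.card_Icc] at h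
  refine le_trans (le_of_eq ?_) h
  congr 1
  omega

/-! ### Length and number of stops of a path in a sub-rectangle -/

/-- A description of the type-`d` path on `[a, b] × [0, m]`: the finite set `S` of its labels, and a
potential `Φ` on them that bounds the distance travelled (see `exists_walk_visiting`). The length
from the first stop to the last one is at most `len + err`, and the number of distinct stops differs
from `cnt` by at most `err`. -/
structure PathEstimate (k m d : ℕ) (a b : ℤ) (S : Finset (ℤ × ℤ)) (Φ : ℤ × ℤ → ℤ)
    (len cnt err : ℝ) : Prop where
  mem_iff : ∀ p, p ∈ S ↔ p ∈ stopLabels k m d a b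
  mem_rect : ∀ p ∈ S, labelStop k m d a b p ∈ Set.Icc (a, (0 : ℤ)) (b, (m : ℤ))
  covers : ∀ q ∈ Set.Icc (a, (0 : ℤ)) (b, (m : ℤ)), ∃ p ∈ S, l1 q (labelStop k m d a b p) ≤ k
  nonneg : ∀ p ∈ S, 0 ≤ Φ p
  step : ∀ p ∈ S, ∀ q ∈ S, visitKey p < visitKey q →
    (∀ x ∈ S, ¬(visitKey p < visitKey x ∧ visitKey x < visitKey q)) →
      l1 (labelStop k m d a b p) (labelStop k m d a b q) + Φ p ≤ Φ q
  le : ∀ p ∈ S, (Φ p : ℝ) ≤ len + err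
  card : |((S.image (labelStop k m d a b)).card : ℝ) - cnt| ≤ err

theorem abs_clamp_sub_clamp_le (a b x y : ℤ) :
    |max a (min x b) - max a (min y b)| ≤ |x - y| := by
  simp only [abs_eq_max_neg]
  omega

theorem l1_zigzagStop_le (k m : ℕ) (a b : ℤ) (p q : ℤ × ℤ) :
    l1 (zigzagStop k m a b p) (zigzagStop k m a b q) ≤ l1 (tessCentre k p) (tessCentre k q) :=
  add_le_add (abs_clamp_sub_clamp_le _ _ _ _) (abs_clamp_sub_clamp_le _ _ _ _)

theorem l1_tessCentre_succ (k : ℕ) (i j : ℤ) :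
    l1 (tessCentre k (i, j)) (tessCentre k (i, j + 1)) = 2 * k + 1 := by
  simp only [l1, tessCentre]
  have h₁ : i * (k : ℤ) + j * (k + 1) - (i * k + (j + 1) * (k + 1)) = -(k + 1) := by ring
  have h₂ : i * ((k : ℤ) + 1) - j * k - (i * (k + 1) - (j + 1) * k) = k := by ring
  rw [h₁, h₂, abs_neg, abs_of_nonneg (by positivity), abs_of_nonneg (by positivity)]
  ring

theorem l1_tessCentre_next {k : ℕ} {i j j' : ℤ} (h : |j - j'| ≤ 3) :
    l1 (tessCentre k (i, j)) (tessCentre k (i + 1, j')) ≤ 4 * (2 * k + 1) := by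
  simp only [l1, tessCentre]
  have hk : (0 : ℤ) ≤ k := by positivity
  have h := abs_le.1 h
  have h₁ : |i * (k : ℤ) + j * (k + 1) - ((i + 1) * k + j' * (k + 1))| ≤ 4 * k + 3 := by
    rw [abs_le]
    constructor <;> nlinarith
  have h₂ : |i * ((k : ℤ) + 1) - j * k - ((i + 1) * (k + 1) - j' * k)| ≤ 4 * k + 1 := by
    rw [abs_le]
    constructor <;> nlinarith
  linarith

/-- Successive stops of a zigzag path are at distance at most `2k + 1` within a traversal, and at
distance `O(k)` between two traversals. -/
theorem zigzag_step {k m : ℕ} (hk : 1 ≤ k) {a b : ℤ} (hab : a ≤ b) {p q : ℤ × ℤ}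
    (hp : p ∈ zigzagLabels k m a b) (hq : q ∈ zigzagLabels k m a b) (hpq : visitKey p < visitKey q)
    (hcons : ∀ x ∈ zigzagLabels k m a b, ¬(visitKey p < visitKey x ∧ visitKey x < visitKey q)) :
    l1 (tessCentre k p) (tessCentre k q) ≤ (2 * k + 1) + 4 * (2 * k + 1) * (q.1 - p.1) := by
  obtain ⟨i, j⟩ := p
  obtain ⟨i', j'⟩ := q
  have hk0 : (0 : ℤ) ≤ k := by positivity
  simp only [visitKey_lt_iff] at hpq hcons
  rcases hpq with hii | ⟨rfl, hjj⟩
  · -- the next label lies on the next traversal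
    obtain rfl : i' = i + 1 := by
      by_contra hne
      obtain ⟨t, ht⟩ := zigzag_traversals_contiguous (c := i + 1) hp hq (by omega) (by omega)
      exact hcons _ ht ⟨.inl (by simp), .inl (by simp only; omega)⟩
    have hclose : |j - j'| ≤ 3 := by
      by_cases hi : Even i
      · have hi' : ¬Even (i + 1) := by simpa [Int.even_add_one] using hi
        refine zigzag_last_close hk hab hp (fun h => hcons _ h ?_) hq (fun h => hcons _ h ?_)
        · exact ⟨.inr ⟨rfl, by simp [hi]⟩, .inl (by simp)⟩
        · exact ⟨.inl (by simp), .inr ⟨rfl, by simp [hi']⟩⟩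
      · have hi' : Even (i + 1) := by simpa [Int.even_add_one] using hi
        refine zigzag_first_close hk hab hp (fun h => hcons _ h ?_) hq (fun h => hcons _ h ?_)
        · exact ⟨.inr ⟨rfl, by simp [hi]⟩, .inl (by simp)⟩
        · exact ⟨.inl (by simp), .inr ⟨rfl, by simp [hi']⟩⟩
    have := l1_tessCentre_next (k := k) (i := i) hclose
    simp only
    linarith
  · simp only at hjj ⊢
    by_cases hi : Even i
    · simp only [hi, if_true] at hjj
      obtain rfl : j' = j + 1 := by
        by_contra hne
        exact hcons _ (zigzagLabels_ordConnected hab hp hq (t := j + 1) (by omega) (by omega))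
          ⟨.inr ⟨rfl, by simp [hi]⟩, .inr ⟨rfl, by simp only [hi, if_true]; omega⟩⟩
      rw [l1_tessCentre_succ]
      simp
    · simp only [hi, if_false] at hjj
      obtain rfl : j = j' + 1 := by
        by_contra hne
        exact hcons _ (zigzagLabels_ordConnected hab hq hp (t := j' + 1) (by omega) (by omega))
          ⟨.inr ⟨rfl, by simp only [hi, if_false]; omega⟩, .inr ⟨rfl, by simp [hi]⟩⟩
      rw [l1_comm, l1_tessCentre_succ]
      simp

theorem exists_pathEstimate_zigzag {k m : ℕ} (hk : 1 ≤ k) (w : ℕ) {a b : ℤ} (hb : b = a + w) :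
    ∃ S Φ, PathEstimate k m (2 * k + 1) a b S Φ ((2 * k + 1) * (w * m) / ballSize k)
      (w * m / ballSize k) (60 * (w + m + k)) := by
  classical
  have hab : a ≤ b := by omega
  have hpt : labelStop k m (2 * k + 1) a b = zigzagStop k m a b := by simp [labelStop]
  have hlab : stopLabels k m (2 * k + 1) a b = zigzagLabels k m a b := by simp [stopLabels]
  obtain ⟨S, hS⟩ : ∃ S : Finset (ℤ × ℤ), ∀ p, p ∈ S ↔ p ∈ zigzagLabels k m a b :=
    ⟨(zigzagLabels_finite k m a b).toFinset, by simp⟩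
  have hcov : ∀ q ∈ Set.Icc (a, (0 : ℤ)) (b, (m : ℤ)),
      ∃ p ∈ S, l1 q (zigzagStop k m a b p) ≤ k := by
    intro q hq
    obtain ⟨p, hp⟩ := exists_tessCentre_near k q
    refine ⟨p, (hS p).2 ⟨q, hq, hp⟩, le_trans ?_ hp⟩
    have h₁ := abs_clamp_sub_clamp_le a b q.1 (tessCentre k p).1
    have h₂ := abs_clamp_sub_clamp_le 0 m q.2 (tessCentre k p).2
    simp only [Set.mem_Icc, Prod.le_def] at hq
    have e₁ : max a (min q.1 b) = q.1 := by omega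
    have e₂ : max 0 (min q.2 m) = q.2 := by omega
    rw [e₁] at h₁
    rw [e₂] at h₂
    rw [l1_comm _ q]
    exact add_le_add h₁ h₂
  obtain ⟨p₀, hp₀, -⟩ := hcov (a, 0) (by simp [Prod.le_def, hab])
  obtain ⟨p₁, hp₁, hmin⟩ := S.exists_min_image Prod.fst ⟨p₀, hp₀⟩
  -- `rk p` is the number of labels visited before `p`
  let rk : ℤ × ℤ → ℕ := fun p => (S.filter fun x => visitKey x < visitKey p).card
  have hrk : ∀ p ∈ S, ∀ q, visitKey p < visitKey q → rk p + 1 ≤ rk q := by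
    intro p hp q hpq
    refine Finset.card_lt_card (Finset.ssubset_iff.2 ⟨p, by simp, ?_⟩)
    intro x hx
    rcases Finset.mem_insert.1 hx with rfl | hx
    · exact Finset.mem_filter.2 ⟨hp, hpq⟩
    · rw [Finset.mem_filter] at hx ⊢
      exact ⟨hx.1, hx.2.trans hpq⟩
  have hcard := card_mul_ballSize_le (k := k) (m := m) (w := w) (a := a) (S := S)
    fun p hp => hb ▸ (hS p).1 hp
  have hcard' : (S.card : ℝ) * ballSize k ≤ (w + 4 * k + 1) * (m + 4 * k + 1) := by
    exact_mod_cast hcard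
  have hlow : ((w : ℝ) + 1) * (m + 1) ≤ (S.image (zigzagStop k m a b)).card * ballSize k := by
    have := le_card_mul_ballSize (k := k) (m := m) (w := w) (a := a)
      (A := S.image (zigzagStop k m a b)) (by
        intro q hq
        obtain ⟨p, hp, h⟩ := hcov q (by rw [hb]; simpa using hq)
        exact ⟨_, Finset.mem_image_of_mem _ hp, h⟩)
    exact_mod_cast this
  have hF : (ballSize k : ℝ) = 2 * k ^ 2 + 2 * k + 1 := by simp [ballSize]
  have hk' : (1 : ℝ) ≤ k := by exact_mod_cast hk
  have hw' : (0 : ℝ) ≤ w := by positivity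
  have hm' : (0 : ℝ) ≤ m := by positivity
  have hF0 : (0 : ℝ) < ballSize k := by rw [hF]; positivity
  -- `2k + 1` for each label, and another `4 (2k + 1)` for each transition
  refine ⟨S, fun p => (2 * k + 1) * rk p + 4 * (2 * k + 1) * (p.1 - p₁.1), ?_⟩
  constructor
  · rw [hlab]
    exact hS
  · intro p _
    rw [hpt]
    simp only [zigzagStop, Set.mem_Icc, Prod.mk_le_mk]
    omega
  · rw [hpt]
    exact hcov
  · intro p hp
    have := sub_nonneg.2 (hmin p hp)
    positivity
  · intro p hp q hq hpq hcons
    rw [hpt]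
    have h₁ := zigzag_step hk hab ((hS p).1 hp) ((hS q).1 hq) hpq fun x hx => hcons x ((hS x).2 hx)
    have h₂ := l1_zigzagStop_le k m a b p q
    have h₃ : ((rk p : ℤ) + 1) * (2 * k + 1) ≤ rk q * (2 * k + 1) :=
      mul_le_mul_of_nonneg_right (by exact_mod_cast hrk p hp q hpq) (by positivity)
    linarith
  · intro p hp
    have hrkp : (rk p : ℝ) * ballSize k ≤ (w + 4 * k + 1) * (m + 4 * k + 1) :=
      le_trans (mul_le_mul_of_nonneg_right
        (by exact_mod_cast Finset.card_filter_le _ _) hF0.le) hcard'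
    -- `k x + (k + 1) y` is the index of the traversal, times `2 k² + 2 k + 1`
    have hidx : (ballSize k : ℤ) * (p.1 - p₁.1) ≤ k * (w + 2 * k) + (k + 1) * (m + 2 * k) := by
      have h₁ := tessCentre_mem_of_mem_zigzagLabels ((hS p).1 hp)
      have h₂ := tessCentre_mem_of_mem_zigzagLabels ((hS p₁).1 hp₁)
      have e : (ballSize k : ℤ) * (p.1 - p₁.1) =
          k * ((tessCentre k p).1 - (tessCentre k p₁).1) +
            (k + 1) * ((tessCentre k p).2 - (tessCentre k p₁).2) := by
        simp only [ballSize, tessCentre]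
        push_cast
        ring
      rw [e]
      refine add_le_add (mul_le_mul_of_nonneg_left ?_ (by positivity))
        (mul_le_mul_of_nonneg_left ?_ (by positivity)) <;> omega
    have hidx' : (ballSize k : ℝ) * (p.1 - p₁.1) ≤ k * (w + 2 * k) + (k + 1) * (m + 2 * k) := by
      exact_mod_cast hidx
    push_cast
    rw [← sub_le_iff_le_add, le_div_iff₀ hF0]
    have e₁ : (2 * k + 1) * (rk p * (ballSize k : ℝ)) ≤
        (2 * k + 1) * ((w + 4 * k + 1) * (m + 4 * k + 1)) :=
      mul_le_mul_of_nonneg_left hrkp (by positivity)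
    have e₂ : 4 * (2 * (k : ℝ) + 1) * (ballSize k * (p.1 - p₁.1)) ≤
        4 * (2 * k + 1) * (k * (w + 2 * k) + (k + 1) * (m + 2 * k)) :=
      mul_le_mul_of_nonneg_left hidx' (by positivity)
    have e₃ : (2 * (k : ℝ) + 1) * ((w + 4 * k + 1) * (m + 4 * k + 1)) +
        4 * (2 * k + 1) * (k * (w + 2 * k) + (k + 1) * (m + 2 * k)) ≤
        (2 * k + 1) * (w * m) + 60 * (w + m + k) * ballSize k := by
      rw [hF]
      have h₁ : 0 ≤ (w : ℝ) * k := by positivity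
      have h₂ : 0 ≤ (m : ℝ) * k := by positivity
      have h₃ : 0 ≤ (w : ℝ) * k ^ 2 := by positivity
      have h₄ : 0 ≤ (m : ℝ) * k ^ 2 := by positivity
      nlinarith [pow_pos (zero_lt_one.trans_le hk') 3, pow_pos (zero_lt_one.trans_le hk') 2]
    linarith
  · rw [hpt, abs_le]
    have h₁ : (w : ℝ) * m / ballSize k ≤ (S.image (zigzagStop k m a b)).card := by
      rw [div_le_iff₀ hF0]
      linarith
    have h₂ : ((S.image (zigzagStop k m a b)).card : ℝ) ≤ S.card := by
      exact_mod_cast Finset.card_image_le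
    have h₃ : (S.card : ℝ) ≤ w * m / ballSize k + 60 * (w + m + k) := by
      rw [← sub_le_iff_le_add, le_div_iff₀ hF0]
      rw [hF] at hcard' ⊢
      have h₃ : 0 ≤ (w : ℝ) * k ^ 2 := by positivity
      have h₄ : 0 ≤ (m : ℝ) * k ^ 2 := by positivity
      have h₁ : 0 ≤ (w : ℝ) * k := by positivity
      have h₂ : 0 ≤ (m : ℝ) * k := by positivity
      nlinarith [pow_pos (zero_lt_one.trans_le hk') 3, pow_pos (zero_lt_one.trans_le hk') 2]
    constructor <;> linarith

/-! ### Up-and-down paths with vertical traversals -/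

/-- Up to an additive constant, a traversal with offset `c` has `m / d` stops. -/
theorem card_heights_bounds {m d c : ℕ} (hd : 0 < d) (hc : c < d) {H : Finset ℤ}
    (hH : ∀ y, y ∈ H ↔ 0 ≤ y ∧ y ≤ m ∧ (y = m ∨ y % d = c)) :
    m / d ≤ H.card ∧ H.card ≤ m / d + 2 := by
  classical
  have hdm := Nat.div_add_mod m d
  have hml := Nat.mod_lt m hd
  have hdm' : (d : ℤ) * ((m / d : ℕ) : ℤ) + ((m % d : ℕ) : ℤ) = m := by exact_mod_cast hdm
  have hinj : Function.Injective fun t : ℕ => (c : ℤ) + t * d := by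
    intro t t' h
    have h' : (t : ℤ) * d = t' * d := by simpa using h
    exact_mod_cast mul_right_cancel₀ (by positivity) h'
  constructor
  · rw [← Finset.card_range (m / d), ← Finset.card_image_of_injective (Finset.range (m / d)) hinj]
    refine Finset.card_le_card fun y hy => ?_
    obtain ⟨t, ht, rfl⟩ := Finset.mem_image.1 hy
    have ht : (t : ℤ) + 1 ≤ (m / d : ℕ) := by exact_mod_cast Finset.mem_range.1 ht
    rw [hH]
    refine ⟨by positivity, ?_, .inr ?_⟩
    · have := mul_le_mul_of_nonneg_right ht (show (0 : ℤ) ≤ d by positivity)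
      have : (0 : ℤ) ≤ (m % d : ℕ) := by positivity
      have : (c : ℤ) < d := by exact_mod_cast hc
      linarith
    · rw [Int.add_mul_emod_self_right]
      exact Int.emod_eq_of_lt (by positivity) (by exact_mod_cast hc)
  · have hsub : H ⊆ insert (m : ℤ)
        ((Finset.range (m / d + 1)).image fun t : ℕ => (c : ℤ) + t * d) := by
      intro y hy
      obtain ⟨h₀, hm, rfl | hy⟩ := (hH y).1 hy
      · simp
      · refine Finset.mem_insert_of_mem (Finset.mem_image.2 ⟨(y / d).toNat, ?_, ?_⟩)
        · rw [Finset.mem_range, Nat.lt_succ_iff, Int.toNat_le]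
          push_cast
          exact Int.ediv_le_ediv (by positivity) hm
        · have := Int.emod_add_mul_ediv y d
          rw [Int.toNat_of_nonneg (Int.ediv_nonneg h₀ (by positivity)), ← hy]
          linarith
    refine (Finset.card_le_card hsub).trans ((Finset.card_insert_le _ _).trans ?_)
    have := Finset.card_image_le (s := Finset.range (m / d + 1)) (f := fun t : ℕ => (c : ℤ) + t * d)
    rw [Finset.card_range] at this
    omega

/-- The vertical distances of a point to the nearest stops on an even and on an odd traversal add up
to at most `d / 2`. -/
theorem exists_near_heights {m d : ℕ} (hd : d = 1 ∨ 2 ≤ d ∧ Even d) {y : ℤ} (h₀ : 0 ≤ y)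
    (hm : y ≤ m) : ∃ v h h' : ℤ, 0 ≤ v ∧ v ≤ (d / 2 : ℕ) ∧
      (0 ≤ h ∧ h ≤ m ∧ (h = m ∨ h % d = 0) ∧ |y - h| ≤ v) ∧
      (0 ≤ h' ∧ h' ≤ m ∧ (h' = m ∨ h' % d = (d / 2 : ℕ)) ∧ |y - h'| ≤ (d / 2 : ℕ) - v) := by
  have hd0 : (0 : ℤ) < d := by rcases hd with rfl | hd <;> omega
  set e := d / 2 with he
  have hed : e < d := Nat.div_lt_self (by exact_mod_cast hd0) (by norm_num)
  have hed' : d = 1 ∧ e = 0 ∨ d = 2 * e := by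
    rcases hd with rfl | ⟨-, hd⟩
    · exact .inl ⟨rfl, rfl⟩
    · exact .inr (Nat.two_mul_div_two_of_even hd).symm
  obtain ⟨t, ρ, rfl, hρ₀, hρ, ht⟩ : ∃ t ρ : ℤ, y = t * d + ρ ∧ 0 ≤ ρ ∧ ρ < d ∧ 0 ≤ t * d := by
    refine ⟨y / d, y % d, ?_, Int.emod_nonneg _ hd0.ne', Int.emod_lt_of_pos _ hd0, ?_⟩
    · have := Int.emod_add_mul_ediv y d
      linarith
    · exact mul_nonneg (Int.ediv_nonneg h₀ hd0.le) hd0.le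
  have hE : (t * d + e) % d = (e : ℤ) := by
    rw [add_comm, Int.add_mul_emod_self_right]
    exact Int.emod_eq_of_lt (by positivity) (by exact_mod_cast hed)
  have h0 : (t * d) % (d : ℤ) = 0 := Int.mul_emod_left _ _
  have h1 : (t * d + d) % (d : ℤ) = 0 := by simp
  simp only [abs_le]
  by_cases hρe : ρ ≤ e
  · refine ⟨ρ, t * d, min (t * d + e) m, hρ₀, hρe, ⟨ht, by omega, .inr h0, by omega⟩,
      by omega, by omega, ?_, by omega⟩
    rcases le_total (t * d + (e : ℤ)) m with h | h
    · exact .inr (by rw [min_eq_left h, hE])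
    · exact .inl (min_eq_right h)
  · refine ⟨d - ρ, min (t * d + d) m, t * d + e, by omega, by omega, ⟨by omega, by omega, ?_,
      by omega⟩, by omega, by omega, .inr hE, by omega⟩
    rcases le_total (t * d + (d : ℤ)) m with h | h
    · exact .inr (by rw [min_eq_left h, h1])
    · exact .inl (min_eq_right h)

/-- The traversals are numbered from `0` to `⌈w / r⌉`. -/
theorem traversal_iff {r w q : ℕ} (hq : w ≤ q * r) (hq' : q * r < w + r) {i : ℤ} (hi : 0 ≤ i) :
    (i = 0 ∨ (i - 1) * r < w) ↔ i ≤ q := by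
  have hq : (w : ℤ) ≤ q * r := by exact_mod_cast hq
  have hq' : (q : ℤ) * r < w + r := by exact_mod_cast hq'
  have hr : (0 : ℤ) ≤ r := by positivity
  constructor
  · rintro (rfl | h)
    · positivity
    · by_contra! hc
      have := mul_le_mul_of_nonneg_right (show (q : ℤ) ≤ i - 1 by omega) hr
      linarith
  · intro h
    by_cases hi0 : i = 0
    · exact .inl hi0
    · right
      have := mul_le_mul_of_nonneg_right h hr
      linarith

/-- The radius-`k` balls around the stops of an up-and-down path cover the rectangle. A point
between two traversals that is at distance more than `k` from the nearest stop on the left is close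
to a stop on the right. -/
theorem upDown_covers {k m d : ℕ} (hd : d = 1 ∨ 2 ≤ d ∧ Even d) (hdk : d / 2 ≤ k) {a b : ℤ}
    {q : ℤ × ℤ} (hq : q ∈ Set.Icc (a, (0 : ℤ)) (b, (m : ℤ))) :
    ∃ p ∈ upDownLabels k m d a b, l1 q (upDownStop k d a b p) ≤ k := by
  obtain ⟨x, y⟩ := q
  simp only [Set.mem_Icc, Prod.mk_le_mk] at hq
  obtain ⟨v, h, h', hv, hv', ⟨hh₀, hhm, hh, hhv⟩, hh₀', hhm', hh', hhv'⟩ :=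
    exists_near_heights hd hq.1.2 hq.2.2
  set r := separation k d with hr
  have hr' : (r : ℤ) = 2 * k + 1 - (d / 2 : ℕ) := by
    rw [hr, separation]
    omega
  have hr0 : (0 : ℤ) < r := by omega
  obtain ⟨i, σ, hx, hσ₀, hσ, hi, hir⟩ : ∃ i σ : ℤ, x = a + i * r + σ ∧ 0 ≤ σ ∧ σ < r ∧ 0 ≤ i ∧
      0 ≤ i * r := by
    have h := Int.ediv_nonneg (show 0 ≤ x - a by omega) hr0.le
    refine ⟨(x - a) / r, (x - a) % r, ?_, Int.emod_nonneg _ hr0.ne', Int.emod_lt_of_pos _ hr0, h,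
      mul_nonneg h hr0.le⟩
    have := Int.emod_add_mul_ediv (x - a) r
    linarith
  have hleft : ∀ z : ℤ, 0 ≤ z → z ≤ m → (z = m ∨ z % d = if Even i then 0 else ((d / 2 : ℕ) : ℤ)) →
      σ + |y - z| ≤ k → ∃ p ∈ upDownLabels k m d a b, l1 (x, y) (upDownStop k d a b p) ≤ k := by
    intro z hz₀ hzm hz hle
    refine ⟨(i, z), ⟨hi, ?_, hz₀, hzm, hz⟩, ?_⟩
    · right
      have : (i - 1) * (r : ℤ) = i * r - r := by ring
      simp only [← hr]
      omega
    · simp only [l1, upDownStop, ← hr]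
      rw [min_eq_left (by omega), show x - (a + i * r) = σ by omega, abs_of_nonneg hσ₀]
      exact hle
  have hright : 0 < σ → ∀ z : ℤ, 0 ≤ z → z ≤ m →
      (z = m ∨ z % d = if Even (i + 1) then 0 else ((d / 2 : ℕ) : ℤ)) → r - σ + |y - z| ≤ k →
      ∃ p ∈ upDownLabels k m d a b, l1 (x, y) (upDownStop k d a b p) ≤ k := by
    intro hσ z hz₀ hzm hz hle
    refine ⟨(i + 1, z), ⟨by simp only; omega, ?_, hz₀, hzm, hz⟩, ?_⟩
    · right
      simp only [← hr, add_sub_cancel_right]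
      omega
    · have : (i + 1) * (r : ℤ) = i * r + r := by ring
      simp only [l1, upDownStop, ← hr]
      refine le_trans (add_le_add_left ?_ _) hle
      rw [abs_le]
      omega
  by_cases hpar : Even i
  · have hpar' : ¬Even (i + 1) := by simpa [Int.even_add_one] using hpar
    by_cases hle : σ + v ≤ k
    · exact hleft h hh₀ hhm (by simpa [hpar] using hh) (by omega)
    · exact hright (by omega) h' hh₀' hhm' (by simpa only [hpar', if_false] using hh') (by omega)
  · have hpar' : Even (i + 1) := by simpa [Int.even_add_one] using hpar
    by_cases hle : σ + ((d / 2 : ℕ) - v) ≤ k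
    · exact hleft h' hh₀' hhm' (by simpa only [hpar, if_false] using hh') (by omega)
    · exact hright (by omega) h hh₀ hhm (by simpa only [hpar', if_true] using hh) (by omega)

theorem exists_pathEstimate_upDown {k m d : ℕ} (hk : 1 ≤ k) (hd : d = 1 ∨ 2 ≤ d ∧ Even d)
    (hdk : d ≤ 2 * k) (w : ℕ) {a b : ℤ} (hb : b = a + w) :
    ∃ S Φ, PathEstimate k m d a b S Φ (w * m / separation k d) (w * m / (separation k d * d))
      (60 * (w + m + k)) := by
  classical
  have hpt : labelStop k m d a b = upDownStop k d a b := by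
    rw [labelStop, if_neg (by omega)]
  have hlab : stopLabels k m d a b = upDownLabels k m d a b := by
    rw [stopLabels, if_neg (by omega)]
  have hd0 : 0 < d := by rcases hd with rfl | hd <;> omega
  set r := separation k d with hr
  have hr0 : 0 < r := by
    rw [hr, separation]
    omega
  have hrk : r ≤ 2 * k + 1 := Nat.sub_le _ _
  obtain ⟨q, hq, hq'⟩ : ∃ q : ℕ, w ≤ q * r ∧ q * r < w + r := by
    refine ⟨(w + r - 1) / r, ?_⟩
    have := Nat.div_add_mod (w + r - 1) r
    have := Nat.mod_lt (w + r - 1) hr0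
    rw [mul_comm]
    omega
  have htr := fun i hi => traversal_iff (i := i) hq hq' hi
  let S : Finset (ℤ × ℤ) := (Finset.Icc ((0 : ℤ), (0 : ℤ)) ((q : ℤ), (m : ℤ))).filter fun p =>
    p.2 = m ∨ p.2 % d = if Even p.1 then 0 else ((d / 2 : ℕ) : ℤ)
  have hS : ∀ p, p ∈ S ↔ (0 ≤ p.1 ∧ p.1 ≤ q) ∧ (0 ≤ p.2 ∧ p.2 ≤ m) ∧
      (p.2 = m ∨ p.2 % d = if Even p.1 then 0 else ((d / 2 : ℕ) : ℤ)) := by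
    intro p
    simp only [S, Finset.mem_filter, Finset.mem_Icc, Prod.le_def]
    tauto
  have hSlab : ∀ p, p ∈ S ↔ p ∈ upDownLabels k m d a b := by
    intro p
    rw [hS, upDownLabels, Set.mem_ofPred_eq, hb, ← hr, add_lt_add_iff_left]
    constructor
    · rintro ⟨⟨h₁, h₂⟩, ⟨h₃, h₄⟩, h₅⟩
      exact ⟨h₁, (htr _ h₁).2 h₂, h₃, h₄, h₅⟩
    · rintro ⟨h₁, h₂, h₃, h₄, h₅⟩
      exact ⟨⟨h₁, (htr _ h₁).1 h₂⟩, ⟨h₃, h₄⟩, h₅⟩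
  have hrZ : (0 : ℤ) ≤ r := by positivity
  have hqZ : (q : ℤ) * r < w + r := by exact_mod_cast hq'
  have hinj : Set.InjOn (upDownStop k d a b) S := by
    -- all traversals but the last one keep clear of the right side
    have key : ∀ i i' : ℤ, i < i' → i' ≤ q → min (a + i * r) b ≠ min (a + i' * r) b := by
      intro i i' h h'
      have h₁ := mul_le_mul_of_nonneg_right (show i + 1 ≤ i' by omega) hrZ
      have h₂ := mul_le_mul_of_nonneg_right h' hrZ
      have h₃ : (0 : ℤ) < r := by exact_mod_cast hr0
      have h₄ : (i + 1) * (r : ℤ) = i * r + r := by ring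
      omega
    rintro ⟨i, y⟩ hp ⟨i', y'⟩ hp' h
    have hp := (hS _).1 hp
    have hp' := (hS _).1 hp'
    simp only [upDownStop, ← hr, Prod.mk.injEq] at h hp hp'
    rcases lt_trichotomy i i' with hi | hi | hi
    · exact absurd h.1 (key _ _ hi hp'.1.2)
    · rw [hi, h.2]
    · exact absurd h.1.symm (key _ _ hi hp.1.2)
  have hfib : ∀ i ∈ Finset.Icc (0 : ℤ) q,
      m / d ≤ (S.filter fun p => p.1 = i).card ∧ (S.filter fun p => p.1 = i).card ≤ m / d + 2 := by
    intro i hi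
    rw [Finset.mem_Icc] at hi
    have hc : (S.filter fun p => p.1 = i).card =
        ((S.filter fun p => p.1 = i).image Prod.snd).card := by
      refine (Finset.card_image_of_injOn ?_).symm
      intro p hp p' hp' h
      rw [Finset.mem_coe, Finset.mem_filter] at hp hp'
      exact Prod.ext (hp.2.trans hp'.2.symm) h
    rw [hc]
    refine card_heights_bounds (c := if Even i then 0 else d / 2) hd0 ?_ ?_
    · split_ifs
      · exact hd0
      · exact Nat.div_lt_self hd0 (by norm_num)
    · intro y
      simp only [Finset.mem_image, Finset.mem_filter]
      constructor
      · rintro ⟨⟨i', y'⟩, ⟨hp, rfl⟩, rfl⟩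
        have := (hS _).1 hp
        simp only at this ⊢
        refine ⟨this.2.1.1, this.2.1.2, ?_⟩
        push_cast
        exact this.2.2
      · rintro ⟨h₁, h₂, h₃⟩
        refine ⟨(i, y), ⟨(hS _).2 ⟨hi, ⟨h₁, h₂⟩, ?_⟩, rfl⟩, rfl⟩
        push_cast at h₃
        exact h₃
  have hmaps : ∀ p ∈ S, p.1 ∈ Finset.Icc (0 : ℤ) q := fun p hp => by
    rw [Finset.mem_Icc]
    exact ((hS p).1 hp).1
  have hqcard : (Finset.Icc (0 : ℤ) q).card = q + 1 := by
    rw [Int.card_Icc]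
    omega
  have hlow := Finset.mul_card_image_le_card_of_maps_to hmaps (m / d) fun i hi => (hfib i hi).1
  have hup := Finset.card_le_mul_card_image_of_maps_to hmaps (m / d + 2) fun i hi => (hfib i hi).2
  rw [hqcard] at hlow hup
  have hrR : (0 : ℝ) < r := by exact_mod_cast hr0
  have hr1 : (1 : ℝ) ≤ r := by exact_mod_cast hr0
  have hdR : (0 : ℝ) < d := by exact_mod_cast hd0
  have hd1 : (1 : ℝ) ≤ d := by exact_mod_cast hd0
  have hkR : (1 : ℝ) ≤ k := by exact_mod_cast hk
  have hwR : (0 : ℝ) ≤ w := by positivity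
  have hmR : (0 : ℝ) ≤ m := by positivity
  have hqlow : (w : ℝ) / r ≤ q := by
    rw [div_le_iff₀ hrR]
    exact_mod_cast hq
  have hqup : (q : ℝ) ≤ w / r + 1 := by
    rw [← sub_le_iff_le_add, le_div_iff₀ hrR]
    have : (q : ℝ) * r < w + r := by exact_mod_cast hq'
    linarith
  have hwr : (w : ℝ) / r ≤ w := div_le_self hwR hr1
  have hwr0 : 0 ≤ (w : ℝ) / r := by positivity
  have hmd : (m : ℝ) / d ≤ m := div_le_self hmR hd1
  have hmd0 : 0 ≤ (m : ℝ) / d := by positivity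
  -- `m` for each traversal, `r` for each transition, plus the position on the current traversal
  refine ⟨S, fun p => p.1 * (m + r) + if Even p.1 then p.2 else m - p.2, ?_⟩
  constructor
  · rw [hlab]
    exact hSlab
  · intro p hp
    have hp := (hS p).1 hp
    have := mul_nonneg hp.1.1 hrZ
    rw [hpt]
    simp only [upDownStop, Set.mem_Icc, Prod.mk_le_mk, ← hr]
    omega
  · intro x hx
    rw [hpt]
    obtain ⟨p, hp, h⟩ := upDown_covers (k := k) hd (by omega) hx
    exact ⟨p, (hSlab p).2 hp, h⟩
  · intro p hp
    have hp := (hS p).1 hp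
    have := mul_nonneg hp.1.1 (show (0 : ℤ) ≤ m + r by positivity)
    split_ifs <;> omega
  · rintro ⟨i, y⟩ hp ⟨i', y'⟩ hp' hlt -
    have hp := (hS _).1 hp
    have hp' := (hS _).1 hp'
    rw [visitKey_lt_iff] at hlt
    rw [hpt]
    simp only [l1, upDownStop, ← hr] at hp hp' hlt ⊢
    rcases hlt with hi | ⟨rfl, hy⟩
    · have hx : |min (a + i * r) b - min (a + i' * r) b| ≤ (i' - i) * r := by
        have h₁ := mul_le_mul_of_nonneg_right hi.le hrZ
        rw [sub_mul, abs_le]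
        omega
      have e : i' * ((m : ℤ) + r) = i * (m + r) + (i' - i) * m + (i' - i) * r := by ring
      by_cases hi2 : i' = i + 1
      · have e' : (i' - i) * (m : ℤ) = m := by
          rw [hi2]
          ring
        have hpar : Even i' ↔ ¬Even i := by
          rw [hi2, Int.even_add_one]
        have hy : |y - y'| + (if Even i then y else m - y) ≤
            m + if Even i' then y' else m - y' := by
          simp only [hpar, abs_eq_max_neg]
          split_ifs <;> omega
        linarith
      · have e' := mul_le_mul_of_nonneg_right (show 2 ≤ i' - i by omega)
          (show (0 : ℤ) ≤ m by positivity)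
        have hy : |y - y'| + (if Even i then y else m - y) ≤
            2 * m + if Even i' then y' else m - y' := by
          simp only [abs_eq_max_neg]
          split_ifs <;> omega
        linarith
    · rw [sub_self, abs_zero]
      simp only [abs_eq_max_neg]
      split_ifs at hy ⊢ <;> omega
  · intro p hp
    have hp := (hS p).1 hp
    have h₁ := mul_le_mul_of_nonneg_right hp.1.2 (show (0 : ℤ) ≤ m + r by positivity)
    have h₂ : p.1 * (m + r) + (if Even p.1 then p.2 else m - p.2) ≤ (q : ℤ) * m + q * r + m := by
      rw [mul_add, mul_add] at h₁
      rw [mul_add]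
      split_ifs <;> omega
    have h₃ : ((p.1 * (m + r) + (if Even p.1 then p.2 else m - p.2) : ℤ) : ℝ) ≤
        q * m + q * r + m := by exact_mod_cast h₂
    refine h₃.trans ?_
    have h₄ : (q : ℝ) * r ≤ w + r := by exact_mod_cast hq'.le
    have h₅ : (r : ℝ) ≤ 2 * k + 1 := by exact_mod_cast hrk
    have h₆ := mul_le_mul_of_nonneg_right hqup hmR
    have h₇ : (w : ℝ) / r * m = w * m / r := by ring
    linarith
  · rw [hpt, Finset.card_image_of_injOn hinj]
    have hlow' : ((m / d : ℕ) : ℝ) * (q + 1) ≤ S.card := by exact_mod_cast hlow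
    have hup' : (S.card : ℝ) ≤ ((m / d : ℕ) + 2) * (q + 1) := by exact_mod_cast hup
    have hf₁ : ((m / d : ℕ) : ℝ) ≤ m / d := Nat.cast_div_le
    have hf₂ : (m : ℝ) / d - 1 ≤ ((m / d : ℕ) : ℝ) := by
      rw [sub_le_iff_le_add, div_le_iff₀ hdR]
      have h₁ := Nat.div_add_mod m d
      have h₂ := Nat.mod_lt m hd0
      have : m ≤ (m / d + 1) * d := by
        rw [add_mul, mul_comm]
        omega
      exact_mod_cast this
    have hprod : (w : ℝ) * m / (r * d) = w / r * (m / d) := by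
      rw [div_mul_div_comm]
    rw [hprod, abs_le]
    constructor
    · have h₁ : (w : ℝ) / r * (m / d - 1) ≤ w / r * ((m / d : ℕ) : ℝ) :=
        mul_le_mul_of_nonneg_left hf₂ hwr0
      have h₂ : (w : ℝ) / r * ((m / d : ℕ) : ℝ) ≤ (q + 1) * ((m / d : ℕ) : ℝ) :=
        mul_le_mul_of_nonneg_right (by linarith) (by positivity)
      linarith
    · have h₁ : (((m / d : ℕ) : ℝ) + 2) * (q + 1) ≤ (m / d + 2) * (w / r + 2) :=
        mul_le_mul (by linarith) (by linarith) (by positivity) (by positivity)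
      linarith

/-! ### The trade-off curve -/

theorem turningPoint_zero (k : ℕ) : turningPoint k 0 = 1 := rfl

theorem turningPoint_last (k : ℕ) : turningPoint k (k + 1) = 2 * k + 1 := by
  simp [turningPoint]

theorem turningPoint_of_pos {k j : ℕ} (hj : 0 < j) (hjk : j ≤ k) : turningPoint k j = 2 * j := by
  rw [turningPoint, if_neg hj.ne', if_pos hjk]

theorem one_le_turningPoint (k j : ℕ) : 1 ≤ turningPoint k j := by
  unfold turningPoint
  split_ifs <;> omega

theorem fUBD_one {k : ℕ} : fUBD k 1 = 2 * k + 1 := by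
  rw [fUBD, if_pos (by norm_num)]
  ring

theorem fUBD_of_ge {k : ℕ} (hk : 1 ≤ k) {d : ℝ} (hd : 2 * k + 1 ≤ d) :
    fUBD k d = 2 * k ^ 2 + 2 * k + 1 := by
  have : (1 : ℝ) ≤ k := by exact_mod_cast hk
  rw [fUBD, if_neg (by linarith), if_neg (by linarith), if_neg (by linarith)]

/-- `fUBD` on `[2 j, 2 (j + 1)]`. -/
theorem fUBD_of_mem_Icc {k j : ℕ} (hj : 0 < j) (hjk : j < k) {d : ℝ} (h₁ : 2 * j ≤ d)
    (h₂ : d ≤ 2 * j + 2) :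
    fUBD k d = (1 - (d / 2 - j)) * quadValue k (2 * j) +
      (d / 2 - j) * quadValue k (2 * j + 2) := by
  have hj' : (1 : ℝ) ≤ j := by exact_mod_cast hj
  have hjk' : (j : ℝ) + 1 ≤ k := by exact_mod_cast hjk
  rw [fUBD, if_neg (by linarith)]
  rcases eq_or_lt_of_le h₂ with rfl | h₂
  · have hfl : ⌊(2 * (j : ℝ) + 2) / 2⌋₊ = j + 1 := by
      rw [show (2 * (j : ℝ) + 2) / 2 = ((j + 1 : ℕ) : ℝ) by push_cast; ring, Nat.floor_natCast]
    rw [hfl]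
    push_cast
    split_ifs with h₁ h₂
    · rw [show 2 * ((j : ℝ) + 1) = 2 * j + 2 by ring]
      ring
    · rw [show (k : ℝ) = j + 1 by linarith, show 2 * ((j : ℝ) + 1) = 2 * j + 2 by ring]
      ring
    · linarith
  · have hfl : ⌊d / 2⌋₊ = j := by
      rw [Nat.floor_eq_iff (by linarith)]
      constructor <;> linarith
    rw [if_pos (by linarith), hfl]

theorem fUBD_of_mem_Icc_one_two {k : ℕ} (hk : 1 ≤ k) {d : ℝ} (h₂ : d ≤ 2) :
    fUBD k d = (2 - d) * (2 * k + 1) + (d - 1) * quadValue k 2 := by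
  rcases eq_or_lt_of_le h₂ with rfl | h₂
  · rcases eq_or_lt_of_le hk with rfl | hk
    · rw [fUBD, if_neg (by norm_num), if_neg (by norm_num), if_pos (by norm_num)]
      norm_num [quadValue]
    · rw [fUBD_of_mem_Icc one_pos hk (by norm_num) (by norm_num)]
      norm_num
  · rw [fUBD, if_pos h₂]

theorem fUBD_of_mem_Icc_last {k : ℕ} (hk : 1 ≤ k) {d : ℝ} (h₁ : 2 * k ≤ d) (h₂ : d ≤ 2 * k + 1) :
    fUBD k d = (2 * k + 1 - d) * quadValue k (2 * k) + (d - 2 * k) * (2 * k ^ 2 + 2 * k + 1) := by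
  have : (1 : ℝ) ≤ k := by exact_mod_cast hk
  rcases eq_or_lt_of_le h₂ with rfl | h₂
  · rw [fUBD_of_ge hk le_rfl]
    ring
  · rw [fUBD, if_neg (by linarith), if_neg (by linarith), if_pos h₂]

/-- For even `d ≤ 2k` the value is `d` times the separation of the traversals. -/
theorem fUBD_two_mul {k j : ℕ} (hj : 0 < j) (hjk : j ≤ k) :
    fUBD k (2 * j) = 2 * j * (2 * k + 1 - j) := by
  have : quadValue k (2 * j) = 2 * j * (2 * k + 1 - j) := by
    rw [quadValue]
    ring
  rcases eq_or_lt_of_le hjk with rfl | hjk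
  · rw [fUBD_of_mem_Icc_last hj le_rfl (by linarith), this]
    ring
  · rw [fUBD_of_mem_Icc hj hjk le_rfl (by linarith), ← this]
    ring

theorem fUBD_turningPoint_pos {k j : ℕ} (hk : 1 ≤ k) (hj : j ≤ k + 1) :
    0 < fUBD k (turningPoint k j) := by
  rcases Nat.eq_zero_or_pos j with rfl | hj0
  · rw [turningPoint_zero, Nat.cast_one, fUBD_one]
    positivity
  · rcases Nat.lt_or_eq_of_le hj with hj | rfl
    · have h : j ≤ k := by omega
      have h' : (j : ℝ) ≤ k := by exact_mod_cast h
      have hj' : (0 : ℝ) < j := by exact_mod_cast hj0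
      rw [turningPoint_of_pos hj0 h]
      push_cast
      rw [fUBD_two_mul hj0 h]
      have : (0 : ℝ) < 2 * k + 1 - j := by linarith
      positivity
    · rw [turningPoint_last]
      push_cast
      rw [fUBD_of_ge hk le_rfl]
      positivity

/-- `fUBD` is affine between consecutive turning points. -/
theorem fUBD_lineMap {k j : ℕ} (hk : 1 ≤ k) (hj : j ≤ k) {θ : ℝ} (h₀ : 0 ≤ θ) (h₁ : θ ≤ 1) :
    fUBD k ((1 - θ) * turningPoint k j + θ * turningPoint k (j + 1)) =
      (1 - θ) * fUBD k (turningPoint k j) + θ * fUBD k (turningPoint k (j + 1)) := by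
  rcases Nat.eq_zero_or_pos j with rfl | hj0
  · rw [turningPoint_zero, turningPoint_of_pos (j := 0 + 1) one_pos hk]
    push_cast
    rw [fUBD_of_mem_Icc_one_two hk (by linarith), fUBD_of_mem_Icc_one_two hk (d := 1) (by linarith),
      mul_one, fUBD_of_mem_Icc_one_two hk (d := 2) le_rfl]
    ring
  · rw [turningPoint_of_pos hj0 hj]
    rcases Nat.lt_or_eq_of_le hj with hj | rfl
    · rw [turningPoint_of_pos (by omega) hj]
      push_cast
      rw [fUBD_of_mem_Icc hj0 hj (by linarith) (by linarith),
        fUBD_of_mem_Icc hj0 hj (d := 2 * (j : ℝ)) (by linarith) (by linarith),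
        fUBD_of_mem_Icc hj0 hj (d := 2 * ((j : ℝ) + 1)) (by linarith) (by linarith)]
      ring
    · rw [turningPoint_last]
      push_cast
      rw [fUBD_of_mem_Icc_last hk (by linarith) (by linarith),
        fUBD_of_mem_Icc_last hk (d := 2 * (j : ℝ)) (by linarith) (by linarith),
        fUBD_of_mem_Icc_last hk (d := 2 * (j : ℝ) + 1) (by linarith) (by linarith)]
      ring

theorem turningPoint_lt_succ {k j : ℕ} (hk : 1 ≤ k) (hj : j ≤ k) :
    turningPoint k j < turningPoint k (j + 1) := by
  rcases Nat.eq_zero_or_pos j with rfl | hj0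
  · rw [turningPoint_zero, turningPoint_of_pos (j := 0 + 1) one_pos hk]
    norm_num
  · rw [turningPoint_of_pos hj0 hj]
    rcases Nat.lt_or_eq_of_le hj with hj | rfl
    · rw [turningPoint_of_pos (by omega) hj]
      omega
    · rw [turningPoint_last]
      omega

/-- Every slope in `[1, 2k + 1]` lies between two consecutive turning points. -/
theorem exists_turningPoint_interval {k : ℕ} {d : ℝ} (h₁ : 1 ≤ d) (h₂ : d ≤ 2 * k + 1) :
    ∃ j ≤ k, (turningPoint k j : ℝ) ≤ d ∧ d ≤ turningPoint k (j + 1) := by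
  classical
  have hex : ∃ j, d ≤ turningPoint k (j + 1) :=
    ⟨k, by rw [turningPoint_last]; push_cast; exact h₂⟩
  refine ⟨Nat.find hex, Nat.find_min' hex (by rw [turningPoint_last]; push_cast; exact h₂), ?_,
    Nat.find_spec hex⟩
  rcases h : Nat.find hex with _ | j
  · rw [turningPoint_zero]
    exact_mod_cast h₁
  · exact (not_le.1 (Nat.find_min hex (m := j) (by omega))).le

/-- On each piece of `fUBD`, the equation of the curve is linear in `(L, T)`. -/
theorem tradeoffCurve_eq_tradeoffPolyline {k m n : ℕ} (hk : 1 ≤ k) (hm : 0 < m) (hn : 0 < n) :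
    tradeoffCurve k m n = tradeoffPolyline k m n := by
  have hN : (0 : ℝ) < m * n := by positivity
  have hF : (0 : ℝ) < 2 * k ^ 2 + 2 * k + 1 := by positivity
  have hlast : curveVertex k m n (2 * k + 1) =
      (((2 * k + 1) * (m * n) / (2 * k ^ 2 + 2 * k + 1), (m * n) / (2 * k ^ 2 + 2 * k + 1) + 1) :
        ℝ × ℝ) := by
    rw [curveVertex]
    push_cast
    rw [fUBD_of_ge hk le_rfl]
  ext ⟨L, T⟩
  simp only [tradeoffCurve, tradeoffPolyline, Set.mem_ofPred_eq, Set.mem_union, Set.mem_iUnion,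
    Finset.mem_range, hlast, exists_prop]
  constructor
  · rintro ⟨hT, hd, hcurve⟩
    have ht : 0 < T - 1 := by linarith
    generalize ht' : T - 1 = t at ht hd hcurve
    obtain rfl : T = t + 1 := by linarith
    generalize hd' : L / t = d at hd hcurve
    obtain rfl : L = d * t := by rw [← hd']; field_simp
    rcases le_total (2 * k + 1 : ℝ) d with hdk | hdk
    · right
      rw [fUBD_of_ge hk hdk] at hcurve
      have e : (m * n : ℝ) / (2 * k ^ 2 + 2 * k + 1) = t := by
        rw [hcurve]
        field_simp
      rw [mul_div_assoc, e]
      exact ⟨mul_le_mul_of_nonneg_right hdk ht.le, rfl⟩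
    · left
      obtain ⟨j, hj, hjd, hdj⟩ := exists_turningPoint_interval hd hdk
      refine ⟨j, by omega, ?_⟩
      have hf₁ := fUBD_turningPoint_pos (j := j) hk (by omega)
      have hf₂ := fUBD_turningPoint_pos (j := j + 1) hk (by omega)
      have hlt : (turningPoint k j : ℝ) < turningPoint k (j + 1) := by
        exact_mod_cast turningPoint_lt_succ hk hj
      simp only [curveVertex]
      obtain ⟨θ, h₀, h₁, rfl⟩ : ∃ θ : ℝ, 0 ≤ θ ∧ θ ≤ 1 ∧
          d = (1 - θ) * turningPoint k j + θ * turningPoint k (j + 1) := by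
        have hpos := sub_pos.2 hlt
        refine ⟨(d - turningPoint k j) / (turningPoint k (j + 1) - turningPoint k j),
          div_nonneg (by linarith) hpos.le, (div_le_one hpos).2 (by linarith), ?_⟩
        field_simp
        ring
      rw [fUBD_lineMap hk hj h₀ h₁] at hcurve
      generalize fUBD k (turningPoint k j) = f₁ at *
      generalize fUBD k (turningPoint k (j + 1)) = f₂ at *
      generalize (turningPoint k j : ℝ) = d₁ at *
      generalize (turningPoint k (j + 1) : ℝ) = d₂ at *
      -- the weights of the two vertices are their shares in `N = t ((1 - θ) f₁ + θ f₂)`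
      refine ⟨t * ((1 - θ) * f₁) / (m * n), t * (θ * f₂) / (m * n), ?_, ?_, ?_, ?_⟩
      · have := sub_nonneg.2 h₁
        positivity
      · positivity
      · rw [← add_div, ← mul_add, ← hcurve, div_self hN.ne']
      · have e : t * ((1 - θ) * f₁) / (m * n) + t * (θ * f₂) / (m * n) = 1 := by
          rw [← add_div, ← mul_add, ← hcurve, div_self hN.ne']
        simp only [Prod.smul_mk, Prod.mk_add_mk, smul_eq_mul, Prod.mk.injEq]
        constructor
        · field_simp
        · rw [mul_add, mul_add, mul_one, mul_one]
          have e₁ : t * ((1 - θ) * f₁) / (m * n) * (m * n / f₁) = t * (1 - θ) := by field_simp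
          have e₂ : t * (θ * f₂) / (m * n) * (m * n / f₂) = t * θ := by field_simp
          linarith
  · rintro (⟨j, hj, α, β, hα, hβ, hαβ, h⟩ | ⟨hL, hT⟩)
    · have hj : j ≤ k := by omega
      have hf₁ := fUBD_turningPoint_pos (j := j) hk (by omega)
      have hf₂ := fUBD_turningPoint_pos (j := j + 1) hk (by omega)
      have hd₁ : (1 : ℝ) ≤ turningPoint k j := by exact_mod_cast one_le_turningPoint k j
      have hd₂ : (1 : ℝ) ≤ turningPoint k (j + 1) := by exact_mod_cast one_le_turningPoint k (j + 1)
      have hlin := fun θ => fUBD_lineMap (θ := θ) hk hj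
      simp only [curveVertex, Prod.smul_mk, Prod.mk_add_mk, smul_eq_mul, Prod.mk.injEq] at h
      obtain ⟨hL, hT⟩ := h
      generalize fUBD k (turningPoint k j) = f₁ at *
      generalize fUBD k (turningPoint k (j + 1)) = f₂ at *
      generalize (turningPoint k j : ℝ) = d₁ at *
      generalize (turningPoint k (j + 1) : ℝ) = d₂ at *
      have ht : T - 1 = α * (m * n) / f₁ + β * (m * n) / f₂ := by
        rw [← hT]
        linear_combination hαβ
      have hpos : 0 < T - 1 := by
        rw [ht]
        rcases hα.eq_or_lt with rfl | hα
        · obtain rfl : β = 1 := by linarith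
          positivity
        · positivity
      have hθ₀ : 0 ≤ β * (m * n) / f₂ / (T - 1) := by positivity
      have hθ : 1 - β * (m * n) / f₂ / (T - 1) = α * (m * n) / f₁ / (T - 1) := by
        rw [sub_eq_iff_eq_add, ← add_div, ← ht, div_self hpos.ne']
      have hθ₁ : β * (m * n) / f₂ / (T - 1) ≤ 1 := by
        rw [← sub_nonneg, hθ]
        positivity
      have hlin := hlin _ hθ₀ hθ₁
      have hd : L / (T - 1) = (1 - β * (m * n) / f₂ / (T - 1)) * d₁ +
          β * (m * n) / f₂ / (T - 1) * d₂ := by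
        rw [hθ, ← hL]
        field_simp
      refine ⟨by linarith, ?_, ?_⟩
      · rw [hd]
        nlinarith
      · rw [hd, hlin, hθ, mul_add]
        have e₁ : (T - 1) * (α * (m * n) / f₁ / (T - 1) * f₁) = α * (m * n) := by field_simp
        have e₂ : (T - 1) * (β * (m * n) / f₂ / (T - 1) * f₂) = β * (m * n) := by field_simp
        rw [e₁, e₂, ← add_mul, hαβ, one_mul]
    · have hpos : 0 < T - 1 := by
        rw [hT, add_sub_cancel_right]
        positivity
      have hT' : T - 1 = (m * n) / (2 * k ^ 2 + 2 * k + 1) := by linarith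
      have hd : (2 * k + 1 : ℝ) ≤ L / (T - 1) := by
        rw [le_div_iff₀ hpos, hT', ← mul_div_assoc]
        exact hL
      refine ⟨by linarith, by linarith [show (0 : ℝ) ≤ k by positivity], ?_⟩
      rw [fUBD_of_ge hk hd, hT']
      field_simp

/-! ### Mixed paths -/

theorem turningPoint_le_fUBD {k j : ℕ} (hk : 1 ≤ k) (hj : j ≤ k + 1) :
    (turningPoint k j : ℝ) ≤ fUBD k (turningPoint k j) := by
  rcases Nat.eq_zero_or_pos j with rfl | hj0
  · rw [turningPoint_zero, Nat.cast_one, fUBD_one]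
    linarith [show (0 : ℝ) ≤ k by positivity]
  · rcases Nat.lt_or_eq_of_le hj with hj | rfl
    · have h : j ≤ k := by omega
      have h' : (j : ℝ) ≤ k := by exact_mod_cast h
      rw [turningPoint_of_pos hj0 h]
      push_cast
      rw [fUBD_two_mul hj0 h]
      exact le_mul_of_one_le_right (by positivity) (by linarith [show (0 : ℝ) ≤ k by positivity])
    · rw [turningPoint_last]
      push_cast
      rw [fUBD_of_ge hk le_rfl]
      linarith [show (0 : ℝ) ≤ k ^ 2 by positivity]

/-- The path of type `d` on a rectangle of width `w` has about `w m / f(d)` stops, at average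
distance about `d`. -/
theorem exists_pathEstimate {k m j : ℕ} (hk : 1 ≤ k) (hj : j ≤ k + 1) (w : ℕ) {a b : ℤ}
    (hb : b = a + w) :
    ∃ S Φ, PathEstimate k m (turningPoint k j) a b S Φ
      (turningPoint k j * (w * m) / fUBD k (turningPoint k j))
      (w * m / fUBD k (turningPoint k j)) (60 * (w + m + k)) := by
  rcases Nat.eq_zero_or_pos j with rfl | hj0
  · have h := exists_pathEstimate_upDown (m := m) hk (d := 1) (.inl rfl) (by omega) w hb
    have hsep : (separation k 1 : ℝ) = 2 * k + 1 := by simp [separation]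
    rw [turningPoint_zero, Nat.cast_one, fUBD_one, one_mul]
    rw [hsep, Nat.cast_one, mul_one] at h
    exact h
  · rcases Nat.lt_or_eq_of_le hj with hj | rfl
    · have hjk : j ≤ k := by omega
      have hjk' : (j : ℝ) ≤ k := by exact_mod_cast hjk
      have h := exists_pathEstimate_upDown (m := m) hk (d := 2 * j)
        (.inr ⟨by omega, even_two_mul j⟩) (by omega) w hb
      have hsep : (separation k (2 * j) : ℝ) = 2 * k + 1 - j := by
        rw [separation, Nat.mul_div_cancel_left _ two_pos, Nat.cast_sub (by omega)]
        push_cast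
        ring
      have hj' : (0 : ℝ) < j := by exact_mod_cast hj0
      have hs : (0 : ℝ) < 2 * k + 1 - j := by linarith
      rw [turningPoint_of_pos hj0 hjk]
      push_cast at h ⊢
      rw [fUBD_two_mul hj0 hjk, mul_div_mul_left _ _ (by positivity), mul_comm (2 * (j : ℝ))]
      rw [hsep] at h
      exact h
    · have h := exists_pathEstimate_zigzag (m := m) hk w hb
      rw [turningPoint_last]
      simp only [ballSize] at h
      push_cast at h ⊢
      rw [fUBD_of_ge hk le_rfl]
      exact h

theorem PathEstimate.exists_walk {k m n d : ℕ} {a b : ℤ} {S : Finset (ℤ × ℤ)} {Φ : ℤ × ℤ → ℤ}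
    {len cnt err : ℝ} (h : PathEstimate k m d a b S Φ len cnt err) (ha : 0 ≤ a) (hb : b ≤ n)
    (hlen : 0 ≤ len + err) (u : gridPoints m n) :
    ∃ (v : gridPoints m n) (w : (unitGrid m n).Walk u v) (τ : ℤ × ℤ → ℕ),
      TraversesUpDown k d a b w τ ∧ (w.length : ℝ) ≤ m + n + (len + err) := by
  obtain ⟨v, w, τ, hτ, hmono, hend⟩ := exists_walk_visiting visitKey (labelStop k m d a b) Φ u S
    (fun p hp => by
      have := h.mem_rect p hp
      simp only [Set.mem_Icc, Prod.le_def] at this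
      rw [mem_gridPoints]
      omega) h.nonneg visitKey_injective.injOn h.step
  refine ⟨v, w, τ, ⟨fun p hp => hτ p ((h.mem_iff p).2 hp), fun p hp q hq hpq =>
    hmono p ((h.mem_iff p).2 hp) q ((h.mem_iff q).2 hq) (upDownBefore_iff.1 hpq)⟩, ?_⟩
  rcases hend with ⟨-, h0⟩ | ⟨p, hp, -, -, hle⟩
  · rw [h0, Nat.cast_zero]
    positivity
  · have h₁ : (w.length : ℝ) ≤ m + n + Φ p := by exact_mod_cast hle
    linarith [h.le p hp]

theorem TraversesUpDown.append {k m n d : ℕ} {a b : ℤ} {u v x : gridPoints m n}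
    {w : (unitGrid m n).Walk u v} {τ : ℤ × ℤ → ℕ} (h : TraversesUpDown k d a b w τ)
    (w' : (unitGrid m n).Walk v x) : TraversesUpDown k d a b (w.append w') τ := by
  refine ⟨fun p hp => ⟨?_, ?_⟩, h.2⟩
  · rw [SimpleGraph.Walk.length_append]
    exact (h.1 p hp).1.trans (Nat.le_add_right _ _)
  · rw [getVert_append_of_le _ _ (h.1 p hp).1]
    exact (h.1 p hp).2

theorem TraversesUpDown.prepend {k m n d : ℕ} {a b : ℤ} {u v x : gridPoints m n}
    {w' : (unitGrid m n).Walk v x} {τ : ℤ × ℤ → ℕ} (h : TraversesUpDown k d a b w' τ)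
    (w : (unitGrid m n).Walk u v) :
    TraversesUpDown k d a b (w.append w') fun p => w.length + τ p := by
  refine ⟨fun p hp => ⟨?_, ?_⟩, fun p hp q hq hpq => Nat.add_le_add_left (h.2 p hp q hq hpq) _⟩
  · rw [SimpleGraph.Walk.length_append]
    exact Nat.add_le_add_left (h.1 p hp).1 _
  · rw [getVert_append_add]
    exact (h.1 p hp).2

/-- The stops of two adjacent rectangles have at most a column in common. -/
theorem card_inter_le {m : ℕ} {a s b : ℤ} {A B : Finset (ℤ × ℤ)}
    (hA : ∀ p ∈ A, p ∈ Set.Icc (a, (0 : ℤ)) (s, (m : ℤ)))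
    (hB : ∀ p ∈ B, p ∈ Set.Icc (s, (0 : ℤ)) (b, (m : ℤ))) : (A ∩ B).card ≤ m + 1 := by
  have hsub : A ∩ B ⊆ (Finset.Icc (0 : ℤ) m).image fun y => (s, y) := by
    rintro ⟨x, y⟩ hp
    rw [Finset.mem_inter] at hp
    have h₁ := hA _ hp.1
    have h₂ := hB _ hp.2
    simp only [Set.mem_Icc, Prod.mk_le_mk] at h₁ h₂
    obtain rfl : x = s := by omega
    exact Finset.mem_image.2 ⟨y, Finset.mem_Icc.2 ⟨h₁.1.2, h₁.2.2⟩, rfl⟩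
  refine (Finset.card_le_card hsub).trans (Finset.card_image_le.trans ?_)
  rw [Int.card_Icc]
  omega

/-- A mixed path with separating line `x = s`. Its length can be made as large as desired, by going
back and forth along an edge at the end. -/
theorem exists_mixed_path {k m n s t j : ℕ} (hk : 1 ≤ k) (hn : 0 < n) (hnm : n ≤ m) (hj : j ≤ k)
    (hst : s + t = n) {f₁ f₂ d₁ d₂ L : ℝ} (hf₁ : fUBD k (turningPoint k j) = f₁)
    (hf₂ : fUBD k (turningPoint k (j + 1)) = f₂) (hd₁ : turningPoint k j = d₁)
    (hd₂ : turningPoint k (j + 1) = d₂)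
    (hL : d₁ * (s * m) / f₁ + d₂ * (t * m) / f₂ ≤ L + 2 * m) :
    ∃ P : CoveringPath m n k, P.IsMixed (turningPoint k j) (turningPoint k (j + 1)) ∧
      |(P.pathLength : ℝ) - L| ≤ 400 * (k * m) ∧
      |(P.stopCount : ℝ) - (s * m / f₁ + t * m / f₂)| ≤ 400 * (k * m) := by
  classical
  have hf₁0 := fUBD_turningPoint_pos (j := j) hk (by omega)
  have hf₂0 := fUBD_turningPoint_pos (j := j + 1) hk (by omega)
  obtain ⟨S₁, Φ₁, h₁⟩ := exists_pathEstimate (m := m) (j := j) hk (by omega) s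
    (a := 0) (b := s) (by simp)
  obtain ⟨S₂, Φ₂, h₂⟩ := exists_pathEstimate (m := m) (j := j + 1) hk (by omega) t
    (a := s) (b := n) (by rw [← hst]; push_cast; rfl)
  obtain ⟨u, w₁, τ₁, hτ₁, hw₁⟩ := h₁.exists_walk (n := n) le_rfl (by omega) (by positivity)
    ⟨(0, 0), mem_gridPoints.2 (by simp)⟩
  obtain ⟨v, w₂, τ₂, hτ₂, hw₂⟩ := h₂.exists_walk (n := n) (by positivity) le_rfl (by positivity) u
  have hcard₁ := h₁.card
  have hcard₂ := h₂.card
  rw [hf₁, hd₁] at hw₁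
  rw [hf₂, hd₂] at hw₂
  rw [hf₁] at hcard₁
  rw [hf₂] at hcard₂
  obtain ⟨w₃, hw₃⟩ := exists_closed_walk hn v ⌊(L - (w₁.length + w₂.length)) / 2⌋₊
  set A := S₁.image (labelStop k m (turningPoint k j) 0 s) with hA
  set B := S₂.image (labelStop k m (turningPoint k (j + 1)) s n) with hB
  have hAr : ∀ p ∈ A, p ∈ Set.Icc (0, (0 : ℤ)) ((s : ℤ), (m : ℤ)) := by
    intro p hp
    obtain ⟨q, hq, rfl⟩ := Finset.mem_image.1 hp
    exact h₁.mem_rect q hq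
  have hBr : ∀ p ∈ B, p ∈ Set.Icc ((s : ℤ), (0 : ℤ)) ((n : ℤ), (m : ℤ)) := by
    intro p hp
    obtain ⟨q, hq, rfl⟩ := Finset.mem_image.1 hp
    exact h₂.mem_rect q hq
  have hgrid : ∀ p ∈ A ∪ B, p ∈ gridPoints m n := by
    intro p hp
    rw [mem_gridPoints]
    rcases Finset.mem_union.1 hp with hp | hp
    · have := hAr p hp
      simp only [Set.mem_Icc, Prod.le_def] at this
      omega
    · have := hBr p hp
      simp only [Set.mem_Icc, Prod.le_def] at this
      omega
  have hmemA : ∀ p, p ∈ A ↔ p ∈ labelStop k m (turningPoint k j) 0 s ''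
      stopLabels k m (turningPoint k j) 0 s := by
    intro p
    simp only [hA, Finset.mem_image, Set.mem_image, h₁.mem_iff]
  have hmemB : ∀ p, p ∈ B ↔ p ∈ labelStop k m (turningPoint k (j + 1)) s n ''
      stopLabels k m (turningPoint k (j + 1)) s n := by
    intro p
    simp only [hB, Finset.mem_image, Set.mem_image, h₂.mem_iff]
  have ht₁ := (hτ₁.append w₂).append w₃
  have ht₂ := (hτ₂.prepend w₁).append w₃
  refine ⟨⟨_, v, (w₁.append w₂).append w₃, (A ∪ B).subtype (· ∈ gridPoints m n), ?_, ?_⟩,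
    ⟨s, by omega, ?_, τ₁, _, ht₁, ht₂, ?_⟩, ?_, ?_⟩
  · intro p hp
    rw [Finset.mem_subtype] at hp
    rcases Finset.mem_union.1 hp with hp | hp
    · obtain ⟨q, hq, hqp⟩ := (hmemA _).1 hp
      have := (ht₁.1 q hq).2.trans hqp
      rw [← Subtype.ext this]
      exact SimpleGraph.Walk.getVert_mem_support _ _
    · obtain ⟨q, hq, hqp⟩ := (hmemB _).1 hp
      have := (ht₂.1 q hq).2.trans hqp
      rw [← Subtype.ext this]
      exact SimpleGraph.Walk.getVert_mem_support _ _
  · rintro ⟨p, hp⟩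
    have hp := mem_gridPoints.1 hp
    rcases le_total p.1 (s : ℤ) with hps | hps
    · obtain ⟨q, hq, hle⟩ := h₁.covers p (by simp only [Set.mem_Icc, Prod.le_def]; omega)
      have hmem : _ ∈ A ∪ B := Finset.mem_union_left _ (Finset.mem_image_of_mem _ hq)
      exact ⟨⟨_, hgrid _ hmem⟩, Finset.mem_subtype.2 hmem, hle⟩
    · obtain ⟨q, hq, hle⟩ := h₂.covers p (by simp only [Set.mem_Icc, Prod.le_def]; omega)
      have hmem : _ ∈ A ∪ B := Finset.mem_union_right _ (Finset.mem_image_of_mem _ hq)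
      exact ⟨⟨_, hgrid _ hmem⟩, Finset.mem_subtype.2 hmem, hle⟩
  · intro p
    rw [Finset.mem_subtype, Finset.mem_union, hmemA, hmemB, Set.mem_union]
  · intro p hp q _
    exact (hτ₁.1 p hp).1.trans (Nat.le_add_right _ _)
  all_goals
    have hkR : (1 : ℝ) ≤ k := by exact_mod_cast hk
    have hmR : (1 : ℝ) ≤ m := by exact_mod_cast hn.trans_le hnm
    have hkm₁ : (m : ℝ) ≤ k * m := le_mul_of_one_le_left (by positivity) hkR
    have hkm₂ : (k : ℝ) ≤ k * m := le_mul_of_one_le_right (by positivity) hmR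
    have hsR : (s : ℝ) + t = n := by exact_mod_cast hst
    have hnR : (n : ℝ) ≤ m := by exact_mod_cast hnm
  · simp only [CoveringPath.pathLength, SimpleGraph.Walk.length_append, hw₃]
    push_cast
    rcases le_total L (w₁.length + w₂.length) with hle | hle
    · rw [Nat.floor_of_nonpos (by linarith), abs_le, Nat.cast_zero]
      constructor <;> linarith
    · have e₁ := Nat.floor_le (show 0 ≤ (L - (w₁.length + w₂.length)) / 2 by linarith)
      have e₂ := Nat.lt_floor_add_one ((L - (w₁.length + w₂.length)) / 2)
      rw [abs_le]
      constructor <;> linarith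
  · have hcard : ((A ∪ B).subtype (· ∈ gridPoints m n)).card = (A ∪ B).card := by
      rw [Finset.card_subtype, Finset.filter_true_of_mem hgrid]
    simp only [CoveringPath.stopCount, hcard]
    have hunion : ((A ∪ B).card : ℝ) + (A ∩ B).card = A.card + B.card := by
      exact_mod_cast Finset.card_union_add_card_inter A B
    have hinter : ((A ∩ B).card : ℝ) ≤ m + 1 := by exact_mod_cast card_inter_le hAr hBr
    have hinter0 : (0 : ℝ) ≤ (A ∩ B).card := by positivity
    rw [abs_le] at hcard₁ hcard₂ ⊢
    constructor <;> linarith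

theorem mainTheorem8 :
    (∀ k m n : ℕ, 1 ≤ k → 0 < n → n ≤ m →
      tradeoffCurve k m n = tradeoffPolyline k m n) ∧
    ∃ C : ℝ, 0 < C ∧ ∀ k m n : ℕ, 1 ≤ k → 0 < n → n ≤ m →
      ∀ L T : ℝ, (L, T) ∈ tradeoffCurve k m n →
        ∃ P : CoveringPath m n k,
          (∃ j : ℕ, j ≤ k ∧ P.IsMixed (turningPoint k j) (turningPoint k (j + 1))) ∧
          |(P.pathLength : ℝ) - L| ≤ C * (k * m) ∧
          |(P.stopCount : ℝ) - T| ≤ C * (k * m) := by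
  have hcurve : ∀ k m n : ℕ, 1 ≤ k → 0 < n → n ≤ m →
      tradeoffCurve k m n = tradeoffPolyline k m n := fun k m n hk hn hnm =>
    tradeoffCurve_eq_tradeoffPolyline hk (hn.trans_le hnm) hn
  refine ⟨hcurve, 500, by norm_num, fun k m n hk hn hnm L T hLT => ?_⟩
  rw [hcurve k m n hk hn hnm] at hLT
  have hkR : (1 : ℝ) ≤ k := by exact_mod_cast hk
  have hmR : (1 : ℝ) ≤ m := by exact_mod_cast hn.trans_le hnm
  have hkm : (m : ℝ) ≤ k * m := le_mul_of_one_le_left (by positivity) hkR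
  simp only [tradeoffPolyline, Set.mem_union, Set.mem_iUnion, Finset.mem_range, exists_prop,
    Set.mem_ofPred_eq] at hLT
  rcases hLT with ⟨j, hj, α, β, hα, hβ, hαβ, h⟩ | ⟨hL, hT⟩
  · have hj : j ≤ k := by omega
    simp only [curveVertex, Prod.smul_mk, Prod.mk_add_mk, smul_eq_mul, Prod.mk.injEq] at h
    obtain ⟨hL, hT⟩ := h
    -- the type changes at `s ≈ α n`; rounding changes length and stop count by `O(m)`
    obtain ⟨s, t, hst, hs₁, hs₂⟩ : ∃ s t : ℕ, s + t = n ∧ (s : ℝ) ≤ α * n ∧ α * n ≤ s + 1 := by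
      have hαn : α * n ≤ n := mul_le_of_le_one_left (by positivity) (by linarith)
      have hle : ⌊α * n⌋₊ ≤ n := Nat.floor_le_of_le hαn
      exact ⟨⌊α * n⌋₊, n - ⌊α * n⌋₊, by omega, Nat.floor_le (by positivity),
        (Nat.lt_floor_add_one _).le⟩
    have htR : (t : ℝ) = n - s := by
      rw [← hst]
      push_cast
      ring
    have hf₁ := fUBD_turningPoint_pos (j := j) hk (by omega)
    have hf₂ := fUBD_turningPoint_pos (j := j + 1) hk (by omega)
    have hle₁ := (div_le_one hf₁).2 (turningPoint_le_fUBD hk (by omega))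
    have hle₂ := (div_le_one hf₂).2 (turningPoint_le_fUBD hk (by omega))
    have hd₁ : (1 : ℝ) ≤ turningPoint k j := by exact_mod_cast one_le_turningPoint k j
    have hd₂ : (1 : ℝ) ≤ turningPoint k (j + 1) := by exact_mod_cast one_le_turningPoint k (j + 1)
    have hround : ∀ c₁ c₂ : ℝ, 0 ≤ c₁ → c₁ ≤ 1 → 0 ≤ c₂ → c₂ ≤ 1 →
        |(c₁ * (s * m) + c₂ * (t * m)) - (α * (c₁ * (m * n)) + β * (c₂ * (m * n)))| ≤ m := by
      intro c₁ c₂ h₁ h₁' h₂ h₂'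
      have e : (c₁ * (s * m) + c₂ * (t * m)) - (α * (c₁ * (m * n)) + β * (c₂ * (m * n))) =
          (α * n - s) * (c₂ - c₁) * m := by
        rw [htR]
        linear_combination -(c₂ * m * n) * hαβ
      rw [e, abs_mul, Nat.abs_cast, abs_mul]
      refine mul_le_of_le_one_left (by positivity) (mul_le_one₀ ?_ (abs_nonneg _) ?_) <;>
        rw [abs_le] <;> constructor <;> linarith
    have hr₁ := hround _ _ (by positivity) hle₁ (by positivity) hle₂
    have hr₂ := hround (fUBD k (turningPoint k j))⁻¹ (fUBD k (turningPoint k (j + 1)))⁻¹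
      (by positivity) (inv_le_one_of_one_le₀ (hd₁.trans (turningPoint_le_fUBD hk (by omega))))
      (by positivity) (inv_le_one_of_one_le₀ (hd₂.trans (turningPoint_le_fUBD hk (by omega))))
    simp only [div_mul_eq_mul_div] at hr₁
    simp only [inv_mul_eq_div] at hr₂
    rw [hL] at hr₁
    rw [abs_le] at hr₁ hr₂
    obtain ⟨P, hP, hlen, hcnt⟩ := exists_mixed_path hk hn hnm hj hst (L := L) rfl rfl rfl rfl
      (by linarith)
    refine ⟨P, ⟨j, hj, hP⟩, hlen.trans (by linarith), ?_⟩
    rw [abs_le] at hcnt ⊢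
    constructor <;> linarith
  · -- on the ray, the path of type `2k + 1` on the whole rectangle is lengthened
    obtain ⟨P, hP, hlen, hcnt⟩ := exists_mixed_path (s := 0) (t := n) hk hn hnm le_rfl (by simp)
      (L := L) rfl rfl rfl rfl (by
        rw [turningPoint_last]
        simp only [curveVertex] at hL
        rw [mul_comm (m : ℝ)] at hL
        simp only [Nat.cast_zero, zero_mul, mul_zero, zero_div]
        linarith)
    refine ⟨P, ⟨k, le_rfl, hP⟩, hlen.trans (by linarith), ?_⟩
    simp only [curveVertex] at hT
    rw [turningPoint_last] at hcnt
    simp only [Nat.cast_zero, zero_mul, zero_div] at hcnt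
    rw [mul_comm (m : ℝ)] at hT
    rw [hT, abs_le]
    rw [abs_le] at hcnt
    constructor <;> linarith
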